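/- **Setting.** Let $d\ge 2$. A *closed, $(d+1)$-valent, $(d+1)$-colored $d$-dimensional lattice* $\mathcal L$ is a finite regular cell complex (a finite set of cells with dimensions, partially ordered by inclusion) such that: every cell contains a vertex; every edge has exactly two end points; at every vertex there are exactly $d+1$ edges, every $k\le d$ of these edges span exactly one $k$-cell at that vertex, and there are no other cells at the vertex; every closed cell is a ball (it is enough that it has the $\mathbb Z/2$-homology of a ball); and the $d$-cells are colored with $C_0,\dots,C_d$ so that any two different $d$-cells with a common $(d-1)$-cell have different colors. The *colors* of a cell are the colors of the $d$-cells containing it. The *color code* $CC(\mathcal L)$ (with point-like excitations) is the stabilizer group on qubits placed on the vertices of $\mathcal L$ generated by $X(c)=\bigotimes_{v\subset c}X(v)$ for all $d$-cells $c$ and $Z(f)=\bigotimes_{v\subset f}Z(v)$ for all $2$-cells $f$. For $j=1,\dots,d$, the *shrunk lattice* $\mathcal L_j$, obtained by shrinking the $d$-cells of color $C_j$ to points, has as vertices the $d$-cells of $\mathcal L$ of color $C_j$; as edges the edges of $\mathcal L$ with colors $\{C_0,\dots,C_d\}\setminus\{C_j\}$, each end point $u$ of such an edge being attached to the $d$-cell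 of color $C_j$ that contains $u$; and as faces the $2$-cells of $\mathcal L$ with colors $\{C_0,\dots,C_d\}\setminus\{C_j,C_i\}$ for some $i\ne j$, the boundary of a face consisting of those edges of the $2$-cell that are edges of $\mathcal L_j$. The *toric code* $TC(\mathcal L_j)$ is the stabilizer group on qubits placed on the edges of $\mathcal L_j$ generated by $X(v)=\bigotimes_e X(e)^{n(v,e)}$ for all vertices $v$ of $\mathcal L_j$, where $n(v,e)\in\{0,1,2\}$ is the number of ends of $e$ at $v$, and $Z(f)=\bigotimes_{e\subset f}Z(e)$ for all faces $f$ of $\mathcal L_j$. For each $d$-cell $c$ of color $C_0$, with $V_c$ vertices and $E_c$ edges, add $E_c-V_c$ ancilla qubits, and let $\mathcal S$ be the stabilizer group generated by the single-qubit Pauli operators $Z$ on all ancilla qubits. A *Clifford unitary* from one register of qubits to another is a unitary $W$ such that $WPW^\dagger$ is in the Pauli group of the second register for every $P$ in the Pauli group of the first. **Theorem (Equivalence).** There is a Clifford unitary $U$ from the register of the vertices of $\mathcal L$ and the ancilla qubits to the register of the edges of $\mathcal L_1,\dots,\mathcal L_d$ such that $$U\,[\,CC(\mathcal L)\otimes\mathcal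 S\,]\,U^\dagger=\bigotimes_{j=1}^{d}TC(\mathcal L_j)$$ (an equality of groups of operators, signs included). Moreover, $U$ is local: $U=\bigotimes_{c\in\mathcal C_0}U_c$, where $\mathcal C_0$ is the set of $d$-cells of color $C_0$ and $U_c$ is a Clifford unitary from the qubits on the vertices of $c$ and the ancilla qubits of $c$ to the toric code qubits on the edges of $c$. -/

import Mathlib

open scoped Matrix

noncomputable section

/-! ### Registers of qubits, Pauli operators, stabilizer groups -/

/-- Computational basis labels of a register of qubits indexed by `Q`. -/
def Config (Q : Type*) : Type _ := Q → Fin 2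

instance Config.instFinite (Q : Type*) [Finite Q] : Finite (Config Q) :=
  inferInstanceAs (Finite (Q → Fin 2))

instance Config.instFintype (Q : Type*) [Finite Q] : Fintype (Config Q) := Fintype.ofFinite _

instance Config.instDecidableEq (Q : Type*) : DecidableEq (Config Q) := Classical.decEq _

/-- Linear maps from the Hilbert space `(ℂ²)^{⊗ Q}` to `(ℂ²)^{⊗ Q'}`, in the computational bases. -/
abbrev LinOp (Q' Q : Type*) : Type _ := Matrix (Config Q') (Config Q) ℂ

/-- Operators on the Hilbert space `(ℂ²)^{⊗ Q}`. -/
abbrev Op (Q : Type*) : Type _ := LinOp Q Q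

/-- The tensor product `⨂_q M_q` of one-qubit operators. -/
def qubitTensor {Q : Type*} (M : Q → Matrix (Fin 2) (Fin 2) ℂ) : Op Q :=
  Matrix.of fun y x => ∏ᶠ q, M q (y q) (x q)

theorem qubitTensor_mul {Q : Type*} [Finite Q] (M N : Q → Matrix (Fin 2) (Fin 2) ℂ) :
    qubitTensor M * qubitTensor N = qubitTensor fun q => M q * N q := by
  classical
  have := Fintype.ofFinite Q
  ext y x
  simp only [qubitTensor, Matrix.mul_apply, Matrix.of_apply, finprod_eq_prod_of_fintype]
  rw [Finset.prod_univ_sum, Fintype.piFinset_univ]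
  exact Fintype.sum_equiv (show Config Q ≃ (Q → Fin 2) from Equiv.refl _)
    (fun z => (∏ q, M q (y q) (z q)) * ∏ q, N q (z q) (x q))
    (fun z => ∏ q, M q (y q) (z q) * N q (z q) (x q)) fun z => Finset.prod_mul_distrib.symm

theorem qubitTensor_one {Q : Type*} [Finite Q] :
    qubitTensor (fun _ : Q => (1 : Matrix (Fin 2) (Fin 2) ℂ)) = 1 := by
  classical
  have := Fintype.ofFinite Q
  ext y x
  simp only [qubitTensor, Matrix.of_apply, finprod_eq_prod_of_fintype, Matrix.one_apply]
  by_cases h : y = x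
  · subst h; simp
  · rw [if_neg h]
    obtain ⟨q, hq⟩ := Function.ne_iff.mp h
    exact Finset.prod_eq_zero (Finset.mem_univ q) (if_neg hq)

/-- The Pauli matrix `X`. -/
def sigmaX : Matrix (Fin 2) (Fin 2) ℂ := !![0, 1; 1, 0]

/-- The Pauli matrix `Z`. -/
def sigmaZ : Matrix (Fin 2) (Fin 2) ℂ := !![1, 0; 0, -1]

theorem sigmaX_mul_self : sigmaX * sigmaX = 1 := by
  simp [sigmaX, Matrix.one_fin_two]

theorem sigmaZ_mul_self : sigmaZ * sigmaZ = 1 := by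
  simp [sigmaZ, Matrix.one_fin_two]

theorem qubitTensor_pow_mul_self {Q : Type*} [Finite Q] {P : Matrix (Fin 2) (Fin 2) ℂ}
    (hP : P * P = 1) (a : Q → ℕ) :
    (qubitTensor fun q => P ^ a q) * (qubitTensor fun q => P ^ a q) = 1 := by
  rw [qubitTensor_mul, ← qubitTensor_one]
  congr 1
  funext q
  rw [← (Commute.refl P).mul_pow, hP, one_pow]

/-- The operator `⨂_q X^{a q}`. -/
def pauliX {Q : Type*} [Finite Q] (a : Q → ℕ) : (Op Q)ˣ where
  val := qubitTensor fun q => sigmaX ^ a q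
  inv := qubitTensor fun q => sigmaX ^ a q
  val_inv := qubitTensor_pow_mul_self sigmaX_mul_self a
  inv_val := qubitTensor_pow_mul_self sigmaX_mul_self a

/-- The operator `⨂_q Z^{a q}`. -/
def pauliZ {Q : Type*} [Finite Q] (a : Q → ℕ) : (Op Q)ˣ where
  val := qubitTensor fun q => sigmaZ ^ a q
  inv := qubitTensor fun q => sigmaZ ^ a q
  val_inv := qubitTensor_pow_mul_self sigmaZ_mul_self a
  inv_val := qubitTensor_pow_mul_self sigmaZ_mul_self a

/-- The operator `X` on every qubit of `s` (identity elsewhere). -/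
def pauliXOn {Q : Type*} [Finite Q] (s : Set Q) : (Op Q)ˣ := pauliX (s.indicator 1)

/-- The operator `Z` on every qubit of `s` (identity elsewhere). -/
def pauliZOn {Q : Type*} [Finite Q] (s : Set Q) : (Op Q)ˣ := pauliZ (s.indicator 1)

/-- The scalar operator `i · 1`. -/
def phaseI (Q : Type*) [Finite Q] : (Op Q)ˣ :=
  Units.map (algebraMap ℂ (Op Q)).toMonoidHom (Units.mk0 Complex.I Complex.I_ne_zero)

/-- The Pauli group, generated by the phase `i` and the one-qubit operators `X_q`, `Z_q`. -/
def pauliGroup (Q : Type*) [Finite Q] : Subgroup (Op Q)ˣ :=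
  Subgroup.closure
    ({phaseI Q} ∪ Set.range (fun q : Q => pauliXOn {q}) ∪ Set.range (fun q : Q => pauliZOn {q}))

/-- A Clifford unitary between two registers: a unitary which conjugates Pauli operators to
Pauli operators. -/
def IsClifford {Q' Q : Type*} [Finite Q'] [Finite Q] (U : LinOp Q' Q) : Prop :=
  Uᴴ * U = 1 ∧ U * Uᴴ = 1 ∧
    ∀ P ∈ pauliGroup Q, ∃ P' ∈ pauliGroup Q', U * (P : Op Q) * Uᴴ = (P' : Op Q')

/-- `U G U†`, for a set `G` of operators. -/
def conjBy {Q' Q : Type*} [Finite Q'] [Finite Q] (U : LinOp Q' Q) (G : Set (Op Q)) :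
    Set (Op Q') :=
  (fun P => U * P * Uᴴ) '' G

/-- `G ⊗ H`: all operators `P ⊗ R` with `P ∈ G` and `R ∈ H`, on the disjoint union of the two
registers. -/
def groupTensor {Q R : Type*} [Finite Q] [Finite R]
    (G : Subgroup (Op Q)ˣ) (H : Subgroup (Op R)ˣ) : Set (Op (Q ⊕ R)) :=
  {M | ∃ P ∈ G, ∃ T ∈ H, M = Matrix.of fun y x =>
    (P : Op Q) (fun q => y (Sum.inl q)) (fun q => x (Sum.inl q)) *
    (T : Op R) (fun r => y (Sum.inr r)) (fun r => x (Sum.inr r))}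

/-- `⨂_j G_j`: all operators `⨂_j P_j` with `P_j ∈ G_j`, on the disjoint union of the registers. -/
def groupTensorFamily {J : Type*} [Finite J] {Q : J → Type*} [∀ j, Finite (Q j)]
    (G : ∀ j, Subgroup (Op (Q j))ˣ) : Set (Op (Σ j, Q j)) :=
  {M | ∃ P : ∀ j, (Op (Q j))ˣ, (∀ j, P j ∈ G j) ∧ M = Matrix.of fun y x =>
    ∏ᶠ j, (P j : Op (Q j)) (fun q => y ⟨j, q⟩) (fun q => x ⟨j, q⟩)}

/-- `⨂_c U_c`, where `U_c` maps the qubits in the region `A c` of the register `Q` to the qubits in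
the region `B c` of the register `Q'`; meant for regions that partition the two registers. -/
def regionTensor {I Q' Q : Type*} {B : I → Set Q'} {A : I → Set Q}
    (U : ∀ c, LinOp (B c) (A c)) : LinOp Q' Q :=
  Matrix.of fun y x => ∏ᶠ c, U c (fun q => y q) (fun q => x q)

/-! ### The toric code -/

/-- The part of a (not necessarily regular) cell complex that the toric code with qubits on edges
needs: `ends v e` is the number of ends of the edge `e` at the vertex `v` (so it is `2` for a loop),
`sides f e` is the number of times that the boundary of the face `f` runs through `e`. -/
structure TwoComplex (V E F : Type*) where
  ends : V → E → ℕ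
  sides : F → E → ℕ

/-- The stabilizer group of the toric code with qubits on edges, `X`-generators at vertices and
`Z`-generators at faces. -/
def TwoComplex.toricCode {V E F : Type*} [Finite E] (K : TwoComplex V E F) : Subgroup (Op E)ˣ :=
  Subgroup.closure
    (Set.range (fun v : V => pauliX (K.ends v)) ∪ Set.range (fun f : F => pauliZ (K.sides f)))

/-! ### Lattices: finite cell complexes, given by their cells ordered by inclusion -/

/-- The mod-2 cellular boundary of a chain (in a regular complex every `k`-cell occurs exactly once
in the boundary of each `(k+1)`-cell containing it). -/
def cellBoundary {Cell : Type*} [PartialOrder Cell] (dim : Cell → ℕ) (z : Cell → ZMod 2) :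
    Cell → ZMod 2 :=
  fun y => ∑ᶠ (x : Cell) (_ : y ≤ x ∧ dim x = dim y + 1), z x

/-- `z` is a mod-2 `k`-chain of the closed cell `c`. -/
def IsChainIn {Cell : Type*} [PartialOrder Cell] (dim : Cell → ℕ) (c : Cell) (k : ℕ)
    (z : Cell → ZMod 2) : Prop :=
  ∀ x, z x ≠ 0 → x ≤ c ∧ dim x = k

/-- The closed cell `c` has the mod-2 cellular homology of a ball: `H₀ = ℤ/2` and `H_k = 0` for
`k > 0`. Every closed cell that is a topological ball satisfies this. -/
def IsHomologyBall {Cell : Type*} [PartialOrder Cell] (dim : Cell → ℕ) (c : Cell) : Prop :=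
  (∀ z, IsChainIn dim c 0 z → ∑ᶠ x, z x = 0 →
    ∃ w, IsChainIn dim c 1 w ∧ cellBoundary dim w = z) ∧
  ∀ k z, IsChainIn dim c (k + 1) z → cellBoundary dim z = 0 →
    ∃ w, IsChainIn dim c (k + 2) w ∧ cellBoundary dim w = z

/-- A finite `d`-dimensional lattice without boundary that is `(d+1)`-valent and whose `d`-cells are
properly colored with the `d + 1` colors `C_0, …, C_d`. Cells are ordered by inclusion. The space
need not be connected, and it need only be a manifold in the sense of mod-2 homology. -/
structure ColoredLattice (Cell : Type*) [PartialOrder Cell] (d : ℕ) where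
  dim : Cell → ℕ
  /-- Color of the `d`-cells (the values at other cells are irrelevant). -/
  color : Cell → Fin (d + 1)
  /-- Every cell contains a vertex. -/
  exists_vertex : ∀ x, ∃ v, v ≤ x ∧ dim v = 0
  /-- Every edge has two end points. -/
  edge_ends : ∀ e, dim e = 1 → {v | dim v = 0 ∧ v ≤ e}.ncard = 2
  /-- `(d+1)`-valence: at every vertex there are `d + 1` edges, and around the vertex the lattice
  looks like the boundary of a `(d+1)`-dimensional orthant: any `k ≤ d` of the edges span exactly
  one `k`-cell, and there are no other cells at the vertex. -/
  valence : ∀ v, dim v = 0 →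
    ∃ φ : Set.Ici v ≃o {T : Finset (Fin (d + 1)) // T ≠ Finset.univ},
      ∀ x : Set.Ici v, dim x = (φ x).1.card
  /-- Different `d`-cells with a common `(d-1)`-cell have different colors. -/
  color_ne : ∀ c c', dim c = d → dim c' = d → c ≠ c' →
    (∃ f, dim f + 1 = d ∧ f ≤ c ∧ f ≤ c') → color c ≠ color c'
  /-- Closed cells are balls, as far as mod-2 homology can tell. -/
  ball : ∀ c, IsHomologyBall dim c

namespace ColoredLattice

variable {Cell : Type*} [PartialOrder Cell] {d : ℕ} (L : ColoredLattice Cell d)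

/-- The `k`-cells. -/
abbrev CellOfDim (k : ℕ) : Type _ := {x : Cell // L.dim x = k}

/-- The `d`-cells of color `C_i`. -/
abbrev CellOfColor (i : Fin (d + 1)) : Type _ := {c : Cell // L.dim c = d ∧ L.color c = i}

/-- The set of vertices of a cell. -/
def verticesOf (x : Cell) : Set (L.CellOfDim 0) := {v | v.1 ≤ x}

/-- The set of edges of a cell. -/
def edgesOf (x : Cell) : Set (L.CellOfDim 1) := {e | e.1 ≤ x}

/-- The colors of a cell: those of the `d`-cells it belongs to. -/
def colorsOf (x : Cell) : Set (Fin (d + 1)) := {i | ∃ c : L.CellOfColor i, x ≤ c.1}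

/-- The stabilizer group of the color code with point-like excitations: qubits on vertices,
`X`-generators on `d`-cells, `Z`-generators on 2-cells. -/
def colorCode [Finite Cell] : Subgroup (Op (L.CellOfDim 0))ˣ :=
  Subgroup.closure
    (Set.range (fun c : L.CellOfDim d => pauliXOn (L.verticesOf c)) ∪
      Set.range (fun f : L.CellOfDim 2 => pauliZOn (L.verticesOf f)))

/-! Vertices, edges and faces of the shrunk lattice `L_i`. -/

/-- Vertices of `L_i`: (the centers of) the `d`-cells of color `C_i`. -/
abbrev ShrunkVertex (i : Fin (d + 1)) : Type _ := L.CellOfColor i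

/-- Edges of `L_i`: the edges with all colors but `C_i`. -/
abbrev ShrunkEdge (i : Fin (d + 1)) : Type _ := {e : L.CellOfDim 1 // L.colorsOf e.1 = {i}ᶜ}

/-- Faces of `L_i`: the 2-cells with all colors but `C_i` and `C_j`, for any `j ≠ i`. -/
abbrev ShrunkFace (i : Fin (d + 1)) : Type _ :=
  {f : L.CellOfDim 2 // ∃ j, j ≠ i ∧ L.colorsOf f.1 = {i, j}ᶜ}

/-- The shrunk lattice `L_i`. After the `d`-cells of color `C_i` have been shrunk to points, an end
of an edge is at the vertex `c` if it was a vertex of the cell `c`, and of the boundary of a face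
those edges are left that have not been shrunk. -/
def shrunk (i : Fin (d + 1)) : TwoComplex (L.ShrunkVertex i) (L.ShrunkEdge i) (L.ShrunkFace i) where
  ends c e := (L.verticesOf e.1.1 ∩ L.verticesOf c.1).ncard
  sides f := Set.indicator {e | e.1.1 ≤ f.1.1} 1

/-- The ancilla qubits: for each `d`-cell `c` of color `C_0` with `V` vertices and `E` edges there
are `E - V` of them. -/
abbrev Ancilla : Type _ :=
  Σ c : L.CellOfColor 0, Fin ((L.edgesOf c.1).ncard - (L.verticesOf c.1).ncard)

/-- The stabilizer group of the decoupled ancilla qubits, generated by the one-qubit `Z`. -/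
def ancillaGroup [Finite Cell] : Subgroup (Op L.Ancilla)ˣ :=
  Subgroup.closure (Set.range fun a : L.Ancilla => pauliZOn {a})

/-- The qubits of the color code together with the ancillas. -/
abbrev SourceQubit : Type _ := L.CellOfDim 0 ⊕ L.Ancilla

/-- The qubits of the toric codes on `L_1, …, L_d`. -/
abbrev TargetQubit : Type _ := Σ j : Fin d, L.ShrunkEdge j.succ

/-- The qubits on the vertices of the cell `c` and the ancilla qubits belonging to `c`. -/
def sourceRegion (c : L.CellOfColor 0) : Set L.SourceQubit :=
  Sum.inl '' L.verticesOf c.1 ∪ Sum.inr '' {a | a.1 = c}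

/-- The toric code qubits on the edges of the cell `c`. -/
def targetRegion (c : L.CellOfColor 0) : Set L.TargetQubit := {q | q.2.1 ∈ L.edgesOf c.1}

end ColoredLattice

end

/-! The theorem reduces to linear algebra over `ZMod 2` on one graph: the vertices of $\mathcal L$
and those edges that have the color $C_0$. Around a vertex a cell is determined by its colors, with
inclusion reversed (`exists_chart`). Hence an edge misses exactly one color; if that color is $C_j$
with $j\ne 0$, the edge carries a qubit of $TC(\mathcal L_j)$ and lies in a unique $d$-cell of color
$C_0$. So the toric code qubits are the edges of this graph, and the graph splits into one block per
cell of color $C_0$.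

Let $M$ be the incidence matrix. Up to factors $Z(k)$ with $Mk=0$, the desired unitary sends $X(w)$
to $X(wM)$ and $Z(Mt)\otimes Z(b)$ to $Z(t)$. A block $c$ is connected ($H_0$ of a ball), so its
cycle space has dimension $E_c-V_c+1$. The operators $Z(k)$ on cycles of $c$ are the images of the
$E_c-V_c$ ancilla operators $Z$ and of the one operator $X(c)$, which a CNOT-type map would send to
the identity because $\mathbf 1M=0$. The extra trade of an $X$ for a $Z$ is made by `foldOp`;
`exists_clifford_of_incidence` builds the block, and `exists_clifford_of_components` takes the
tensor product. No carried relation involves a phase, so signs agree.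

It remains to compare the groups (`map_conjHom_sourceGroup`). Both contain all $Z(k)$ on cycles: the
source because of the trade just described, the target because $H_1(c)=0$ makes every cycle a sum of
boundaries of 2-cells of $c$, each the sum of a face of $\mathcal L_i$ and a face of $\mathcal L_j$
(`mem_of_incidence_mulVec_eq_zero`). Modulo these operators generators correspond. For a $d$-cell
$c$ of color $C_j$, the vector $wM$ of its vertices counts ends of edges at $c$ and vanishes on
edges missing any color other than $C_j$, since such an edge meeting $c$ has both ends in it. For a
2-cell $f$ missing $C_j$, the edges of $f$ that miss $C_j$ match its vertices perfectly, so $M$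
sends that face of $\mathcal L_j$ to the vertex set of $f$ (`incidence_mulVec_shrunkVec`). -/

noncomputable section

/-! ### Pauli operators as operators indexed by binary vectors -/

/-- A basis label, read as a binary vector. -/
def Config.vec {Q : Type*} : Config Q ≃ (Q → ZMod 2) := Equiv.refl _

/-- The sign `(-1)^s`. -/
def binSign (s : ZMod 2) : ℂ := if s = 0 then 1 else -1

theorem binSign_zero : binSign 0 = 1 := by simp [binSign]

theorem binSign_one : binSign 1 = -1 := by simp [binSign]

theorem binSign_add (s t : ZMod 2) : binSign (s + t) = binSign s * binSign t := by
  have h : ∀ u : ZMod 2, u = 0 ∨ u = 1 := by decide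
  have h₂ : (1 : ZMod 2) + 1 = 0 := by decide
  rcases h s with rfl | rfl <;> rcases h t with rfl | rfl <;> simp [binSign, h₂]

/-- The operator `⨂_q X^{a q}`, for a binary vector `a`. -/
def xOp {Q : Type*} [Finite Q] (a : Q → ZMod 2) : (Op Q)ˣ := pauliX fun q => (a q).val

/-- The operator `⨂_q Z^{b q}`, for a binary vector `b`. -/
def zOp {Q : Type*} [Finite Q] (b : Q → ZMod 2) : (Op Q)ˣ := pauliZ fun q => (b q).val

/-- Exponents matter only mod 2. In particular the exponent 2 of a loop in the toric code
contributes nothing. -/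
theorem pow_val_natCast {P : Matrix (Fin 2) (Fin 2) ℂ} (hP : P * P = 1) (n : ℕ) :
    P ^ ((n : ZMod 2).val) = P ^ n := by
  rw [ZMod.val_natCast]
  conv_rhs => rw [← Nat.mod_add_div n 2, pow_add, pow_mul, pow_two, hP, one_pow, mul_one]

theorem pauliX_eq_xOp {Q : Type*} [Finite Q] (a : Q → ℕ) :
    pauliX a = xOp fun q => (a q : ZMod 2) := by
  ext1
  simp only [pauliX, xOp, pow_val_natCast sigmaX_mul_self]

theorem pauliZ_eq_zOp {Q : Type*} [Finite Q] (a : Q → ℕ) :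
    pauliZ a = zOp fun q => (a q : ZMod 2) := by
  ext1
  simp only [pauliZ, zOp, pow_val_natCast sigmaZ_mul_self]

theorem sigmaX_pow_apply (a y x : ZMod 2) :
    (sigmaX ^ a.val) y x = if y = x + a then 1 else 0 := by
  have h : ∀ u : ZMod 2, u = 0 ∨ u = 1 := by decide
  have h₂ : (1 : ZMod 2) + 1 = 0 := by decide
  -- `ZMod 2` unfolds to `Fin 2`, so the matrix entries are definitional.
  have e₀₀ : sigmaX (0 : ZMod 2) (0 : ZMod 2) = 0 := rfl
  have e₀₁ : sigmaX (0 : ZMod 2) (1 : ZMod 2) = 1 := rfl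
  have e₁₀ : sigmaX (1 : ZMod 2) (0 : ZMod 2) = 1 := rfl
  have e₁₁ : sigmaX (1 : ZMod 2) (1 : ZMod 2) = 0 := rfl
  rcases h a with rfl | rfl
  · rw [ZMod.val_zero, pow_zero, add_zero]
    exact Matrix.one_apply
  · rw [ZMod.val_one, pow_one]
    rcases h y with rfl | rfl <;> rcases h x with rfl | rfl <;> simp [e₀₀, e₀₁, e₁₀, e₁₁, h₂]

theorem sigmaZ_pow_apply (a y x : ZMod 2) :
    (sigmaZ ^ a.val) y x = if y = x then binSign (a * x) else 0 := by
  have h : ∀ u : ZMod 2, u = 0 ∨ u = 1 := by decide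
  have e₀₀ : sigmaZ (0 : ZMod 2) (0 : ZMod 2) = 1 := rfl
  have e₀₁ : sigmaZ (0 : ZMod 2) (1 : ZMod 2) = 0 := rfl
  have e₁₀ : sigmaZ (1 : ZMod 2) (0 : ZMod 2) = 0 := rfl
  have e₁₁ : sigmaZ (1 : ZMod 2) (1 : ZMod 2) = -1 := rfl
  rcases h a with rfl | rfl
  · rw [ZMod.val_zero, pow_zero, zero_mul, binSign_zero]
    exact Matrix.one_apply
  · rw [ZMod.val_one, pow_one]
    rcases h y with rfl | rfl <;> rcases h x with rfl | rfl <;>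
      simp [e₀₀, e₀₁, e₁₀, e₁₁, binSign]

theorem binSign_sum {ι : Type*} (s : Finset ι) (f : ι → ZMod 2) :
    binSign (∑ i ∈ s, f i) = ∏ i ∈ s, binSign (f i) := by
  classical
  induction s using Finset.induction_on with
  | empty => simp [binSign_zero]
  | insert a s ha ih => rw [Finset.sum_insert ha, Finset.prod_insert ha, binSign_add, ih]

open Classical in
theorem xOp_apply {Q : Type*} [Finite Q] (a : Q → ZMod 2) (y x : Config Q) :
    (xOp a : Op Q) y x = if y.vec = x.vec + a then 1 else 0 := by
  have := Fintype.ofFinite Q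
  have h : (xOp a : Op Q) y x = ∏ q, (sigmaX ^ (a q).val) (y.vec q) (x.vec q) := by
    rw [← finprod_eq_prod_of_fintype]; rfl
  rw [h]
  simp only [sigmaX_pow_apply]
  rw [Finset.prod_ite_zero]
  simp only [Finset.mem_univ, forall_const, Finset.prod_const_one, funext_iff, Pi.add_apply]

open Classical in
theorem zOp_apply {Q : Type*} [Fintype Q] (b : Q → ZMod 2) (y x : Config Q) :
    (zOp b : Op Q) y x = if y = x then binSign (b ⬝ᵥ x.vec) else 0 := by
  have h : (zOp b : Op Q) y x = ∏ q, (sigmaZ ^ (b q).val) (y.vec q) (x.vec q) := by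
    rw [← finprod_eq_prod_of_fintype]; rfl
  rw [h]
  simp only [sigmaZ_pow_apply]
  rw [Finset.prod_ite_zero, ← binSign_sum]
  simp only [Finset.mem_univ, forall_const, ← funext_iff, EmbeddingLike.apply_eq_iff_eq]
  rfl

theorem zmodTwo_add_self {Q : Type*} (a : Q → ZMod 2) : a + a = 0 := by
  funext q; exact CharTwo.add_self_eq_zero _

theorem mul_xOp_apply {Q Q' : Type*} [Finite Q] (M : LinOp Q' Q) (a : Q → ZMod 2)
    (y : Config Q') (x : Config Q) :
    (M * (xOp a : Op Q)) y x = M y (Config.vec.symm (x.vec + a)) := by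
  classical
  rw [Matrix.mul_apply, Finset.sum_eq_single (Config.vec.symm (x.vec + a))]
  · simp [xOp_apply]
  · intro z _ hz
    rw [xOp_apply, if_neg, mul_zero]
    rintro h
    exact hz (by rw [← h]; simp)
  · simp

theorem xOp_mul_apply {Q Q' : Type*} [Finite Q] (M : LinOp Q Q') (a : Q → ZMod 2)
    (y : Config Q) (x : Config Q') :
    ((xOp a : Op Q) * M) y x = M (Config.vec.symm (y.vec + a)) x := by
  classical
  rw [Matrix.mul_apply, Finset.sum_eq_single (Config.vec.symm (y.vec + a))]
  · simp [xOp_apply, add_assoc, zmodTwo_add_self]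
  · intro z _ hz
    rw [xOp_apply, if_neg, zero_mul]
    rintro h
    exact hz (by rw [h]; simp [add_assoc, zmodTwo_add_self])
  · simp

theorem mul_zOp_apply {Q Q' : Type*} [Fintype Q] (M : LinOp Q' Q) (b : Q → ZMod 2)
    (y : Config Q') (x : Config Q) :
    (M * (zOp b : Op Q)) y x = M y x * binSign (b ⬝ᵥ x.vec) := by
  classical
  rw [Matrix.mul_apply, Finset.sum_eq_single x]
  · simp [zOp_apply]
  · intro z _ hz
    rw [zOp_apply, if_neg hz, mul_zero]
  · simp

theorem zOp_mul_apply {Q Q' : Type*} [Fintype Q] (M : LinOp Q Q') (b : Q → ZMod 2)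
    (y : Config Q) (x : Config Q') :
    ((zOp b : Op Q) * M) y x = binSign (b ⬝ᵥ y.vec) * M y x := by
  classical
  rw [Matrix.mul_apply, Finset.sum_eq_single y]
  · simp [zOp_apply]
  · intro z _ hz
    rw [zOp_apply, if_neg hz.symm, zero_mul]
  · simp

theorem xOp_add {Q : Type*} [Finite Q] (a b : Q → ZMod 2) : xOp (a + b) = xOp a * xOp b := by
  classical
  ext y x
  rw [Units.val_mul, mul_xOp_apply, xOp_apply, xOp_apply]
  simp only [Equiv.apply_symm_apply, add_assoc, add_comm b a]

theorem zOp_add {Q : Type*} [Finite Q] (a b : Q → ZMod 2) : zOp (a + b) = zOp a * zOp b := by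
  classical
  have := Fintype.ofFinite Q
  ext y x
  rw [Units.val_mul, mul_zOp_apply, zOp_apply, zOp_apply, add_dotProduct, binSign_add]
  split_ifs <;> simp

theorem xOp_zero {Q : Type*} [Finite Q] : xOp (0 : Q → ZMod 2) = 1 := by
  have := xOp_add (0 : Q → ZMod 2) 0
  simpa using this

theorem zOp_zero {Q : Type*} [Finite Q] : zOp (0 : Q → ZMod 2) = 1 := by
  have := zOp_add (0 : Q → ZMod 2) 0
  simpa using this

/-- The binary vectors whose `X`-operators lie in `G`. -/
def xVectors {Q : Type*} [Finite Q] (G : Subgroup (Op Q)ˣ) : AddSubmonoid (Q → ZMod 2) where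
  carrier := {a | xOp a ∈ G}
  zero_mem' := by simp [xOp_zero, G.one_mem]
  add_mem' := fun {a b} ha hb => by
    simp only [Set.mem_ofPred_eq, xOp_add] at *; exact G.mul_mem ha hb

/-- The binary vectors whose `Z`-operators lie in `G`. -/
def zVectors {Q : Type*} [Finite Q] (G : Subgroup (Op Q)ˣ) : AddSubmonoid (Q → ZMod 2) where
  carrier := {a | zOp a ∈ G}
  zero_mem' := by simp [zOp_zero, G.one_mem]
  add_mem' := fun {a b} ha hb => by
    simp only [Set.mem_ofPred_eq, zOp_add] at *; exact G.mul_mem ha hb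

/-- Coefficients are 0 or 1, so closure under addition already yields the whole span; no scalars are
needed. -/
theorem mem_of_single_mem {Q : Type*} [Finite Q] [DecidableEq Q]
    (S : AddSubmonoid (Q → ZMod 2)) (h : ∀ q, Pi.single q 1 ∈ S) (a : Q → ZMod 2) : a ∈ S := by
  have := Fintype.ofFinite Q
  rw [← Finset.univ_sum_single a]
  refine S.sum_mem fun q _ => ?_
  have : a q = 0 ∨ a q = 1 := by generalize a q = s; revert s; decide
  rcases this with h0 | h0 <;> rw [h0]
  · rw [Pi.single_zero]; exact S.zero_mem
  · exact h q

open Classical in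
theorem natCast_indicator {Q : Type*} (s : Set Q) :
    (fun q => ((s.indicator (1 : Q → ℕ) q : ℕ) : ZMod 2)) = fun q => if q ∈ s then 1 else 0 := by
  funext q
  by_cases h : q ∈ s <;> simp [h]

theorem pauliXOn_singleton {Q : Type*} [Finite Q] [DecidableEq Q] (q : Q) :
    pauliXOn {q} = xOp (Pi.single q 1) := by
  classical
  rw [pauliXOn, pauliX_eq_xOp, natCast_indicator]
  congr 1; funext p; simp [Pi.single_apply]

theorem pauliZOn_singleton {Q : Type*} [Finite Q] [DecidableEq Q] (q : Q) :
    pauliZOn {q} = zOp (Pi.single q 1) := by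
  classical
  rw [pauliZOn, pauliZ_eq_zOp, natCast_indicator]
  congr 1; funext p; simp [Pi.single_apply]

theorem xOp_mem_pauliGroup {Q : Type*} [Finite Q] (a : Q → ZMod 2) : xOp a ∈ pauliGroup Q := by
  classical
  refine mem_of_single_mem (xVectors (pauliGroup Q)) (fun q => ?_) a
  change xOp (Pi.single q 1) ∈ pauliGroup Q
  rw [← pauliXOn_singleton]
  exact Subgroup.subset_closure (Or.inl (Or.inr ⟨q, rfl⟩))

theorem zOp_mem_pauliGroup {Q : Type*} [Finite Q] (a : Q → ZMod 2) : zOp a ∈ pauliGroup Q := by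
  classical
  refine mem_of_single_mem (zVectors (pauliGroup Q)) (fun q => ?_) a
  change zOp (Pi.single q 1) ∈ pauliGroup Q
  rw [← pauliZOn_singleton]
  exact Subgroup.subset_closure (Or.inr ⟨q, rfl⟩)

/-! ### Conjugation by a unitary -/

/-- Conjugation by a unitary, as a homomorphism of groups of invertible operators. -/
def conjHom {Q' Q : Type*} [Finite Q'] [Finite Q] (U : LinOp Q' Q) (h₁ : Uᴴ * U = 1)
    (h₂ : U * Uᴴ = 1) : (Op Q)ˣ →* (Op Q')ˣ :=
  Units.map
    { toFun := fun P => U * P * Uᴴ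
      map_one' := by rw [Matrix.mul_one, h₂]
      map_mul' := fun P R => by
        have h : U * P * Uᴴ * (U * R * Uᴴ) = U * P * (Uᴴ * U) * R * Uᴴ := by
          simp only [Matrix.mul_assoc]
        rw [h, h₁, Matrix.mul_one, Matrix.mul_assoc U P R] }

theorem coe_conjHom {Q' Q : Type*} [Finite Q'] [Finite Q] (U : LinOp Q' Q) (h₁ : Uᴴ * U = 1)
    (h₂ : U * Uᴴ = 1) (P : (Op Q)ˣ) : (conjHom U h₁ h₂ P : Op Q') = U * (P : Op Q) * Uᴴ := rfl

/-- `U P = R U`: up to the identification of the registers by `U`, the operator `P` is `R`. -/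
def Carries {Q' Q : Type*} [Finite Q'] [Finite Q] (U : LinOp Q' Q) (P : (Op Q)ˣ)
    (R : (Op Q')ˣ) : Prop := U * (P : Op Q) = (R : Op Q') * U

theorem conjHom_eq_of_carries {Q' Q : Type*} [Finite Q'] [Finite Q] {U : LinOp Q' Q}
    (h₁ : Uᴴ * U = 1) (h₂ : U * Uᴴ = 1) {P : (Op Q)ˣ} {R : (Op Q')ˣ}
    (h : Carries U P R) : conjHom U h₁ h₂ P = R := by
  ext1
  rw [coe_conjHom, show U * (P : Op Q) = (R : Op Q') * U from h, Matrix.mul_assoc, h₂, Matrix.mul_one]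

/-- `U` carries each `X`- and each `Z`-operator to a product of an `X`- and a `Z`-operator. -/
def MapsPaulis {Q' Q : Type*} [Finite Q'] [Finite Q] (U : LinOp Q' Q) : Prop :=
  (∀ x, ∃ a b, Carries U (xOp x) (xOp a * zOp b)) ∧
    ∀ z, ∃ a b, Carries U (zOp z) (xOp a * zOp b)

theorem phaseI_mem_pauliGroup (Q : Type*) [Finite Q] : phaseI Q ∈ pauliGroup Q :=
  Subgroup.subset_closure (Or.inl (Or.inl rfl))

/-- Conjugation is a homomorphism and fixes scalars, so it suffices to look at the generators of the
Pauli group. -/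
theorem isClifford_of_mapsPaulis {Q' Q : Type*} [Finite Q'] [Finite Q] {U : LinOp Q' Q}
    (h₁ : Uᴴ * U = 1) (h₂ : U * Uᴴ = 1) (h : MapsPaulis U) : IsClifford U := by
  classical
  refine ⟨h₁, h₂, fun P hP => ⟨conjHom U h₁ h₂ P, ?_, rfl⟩⟩
  suffices pauliGroup Q ≤ (pauliGroup Q').comap (conjHom U h₁ h₂) from this hP
  refine (Subgroup.closure_le _).2 ?_
  rintro _ ((rfl | ⟨q, rfl⟩) | ⟨q, rfl⟩)
  · have : conjHom U h₁ h₂ (phaseI Q) = phaseI Q' := by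
      refine conjHom_eq_of_carries h₁ h₂ ?_
      change U * (algebraMap ℂ (Op Q)) Complex.I = (algebraMap ℂ (Op Q')) Complex.I * U
      simp [Algebra.algebraMap_eq_smul_one]
    change conjHom U h₁ h₂ (phaseI Q) ∈ pauliGroup Q'
    rw [this]
    exact phaseI_mem_pauliGroup Q'
  · obtain ⟨a, b, hab⟩ := h.1 (Pi.single q 1)
    change conjHom U h₁ h₂ (pauliXOn {q}) ∈ pauliGroup Q'
    rw [pauliXOn_singleton, conjHom_eq_of_carries h₁ h₂ hab]
    exact mul_mem (xOp_mem_pauliGroup a) (zOp_mem_pauliGroup b)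
  · obtain ⟨a, b, hab⟩ := h.2 (Pi.single q 1)
    change conjHom U h₁ h₂ (pauliZOn {q}) ∈ pauliGroup Q'
    rw [pauliZOn_singleton, conjHom_eq_of_carries h₁ h₂ hab]
    exact mul_mem (xOp_mem_pauliGroup a) (zOp_mem_pauliGroup b)

/-! ### Tensor products over regions -/

/-- The regions `A c` partition the register. -/
def IsPartition {I Q : Type*} (A : I → Set Q) : Prop := ∀ q, ∃! c, q ∈ A c

/-- For a partition into regions, a function is the same as a family of functions on the regions. -/
def restrictEquiv {I Q : Type*} {A : I → Set Q} (hA : IsPartition A) (α : Type*) :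
    (Q → α) ≃ ∀ c, A c → α :=
  Equiv.ofBijective (fun x c q => x q.1) <| by
    constructor
    · intro x y h
      funext q
      obtain ⟨c, hc, -⟩ := hA q
      exact congrFun (congrFun h c) ⟨q, hc⟩
    · intro g
      choose r hr hr' using hA
      refine ⟨fun q => g (r q) ⟨q, hr q⟩, ?_⟩
      funext c q
      obtain ⟨q, hq⟩ := q
      obtain rfl := hr' q c hq
      rfl

theorem restrictEquiv_apply {I Q : Type*} {A : I → Set Q} (hA : IsPartition A) {α : Type*}
    (x : Q → α) (c : I) (q : A c) : restrictEquiv hA α x c q = x q := rfl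

/-- The function with given restrictions to the regions of a partition. -/
def glue {I Q : Type*} {A : I → Set Q} (hA : IsPartition A) {α : Type*} (g : ∀ c, A c → α) :
    Q → α := (restrictEquiv hA α).symm g

theorem glue_apply {I Q : Type*} {A : I → Set Q} (hA : IsPartition A) {α : Type*}
    (g : ∀ c, A c → α) (c : I) (q : A c) : glue hA g q = g c q := by
  rw [← restrictEquiv_apply hA (glue hA g) c q, glue, Equiv.apply_symm_apply]

/-- Distributivity: a label of the middle register is a family of labels of its regions, so the sum
of products is a product of sums. Only the middle register has to be partitioned. -/
theorem regionTensor_mul {I Q'' Q' Q : Type*} [Finite I] [Finite Q'] {C : I → Set Q''}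
    {B : I → Set Q'} {A : I → Set Q} (hB : IsPartition B)
    (U : ∀ c, LinOp (C c) (B c)) (W : ∀ c, LinOp (B c) (A c)) :
    regionTensor U * regionTensor W = regionTensor fun c => U c * W c := by
  classical
  have := Fintype.ofFinite I
  ext y x
  have h : (regionTensor fun c => U c * W c) y x =
      ∏ c, ∑ z : Config (B c), U c (fun q => y q) z * W c z (fun q => x q) :=
    finprod_eq_prod_of_fintype _
  rw [h, Matrix.mul_apply, Finset.prod_univ_sum, Fintype.piFinset_univ]
  refine Fintype.sum_equiv
    (show Config Q' ≃ (∀ c, Config (B c)) from restrictEquiv hB (Fin 2)) _ _ fun z => ?_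
  simp only [regionTensor, Matrix.of_apply, finprod_eq_prod_of_fintype]
  exact Finset.prod_mul_distrib.symm

theorem qubitTensor_eq_regionTensor {I Q : Type*} [Finite I] [Finite Q] {A : I → Set Q}
    (hA : IsPartition A) (M : Q → Matrix (Fin 2) (Fin 2) ℂ) :
    qubitTensor M = regionTensor fun c => qubitTensor fun q : A c => M q := by
  classical
  have := Fintype.ofFinite I
  have := Fintype.ofFinite Q
  ext y x
  have h : (regionTensor fun c => qubitTensor fun q : A c => M q) y x =
      ∏ c, ∏ q : A c, M q (y q) (x q) := by
    simp only [← finprod_eq_prod_of_fintype]; rfl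
  have h' : qubitTensor M y x = ∏ q, M q (y q) (x q) := finprod_eq_prod_of_fintype _
  rw [h, h', ← Fintype.prod_sigma' (fun c (q : A c) => M q (y q) (x q))]
  refine (Fintype.prod_bijective (fun p : Σ c, A c => (p.2 : Q)) ⟨?_, ?_⟩ _ _ fun _ => rfl).symm
  · rintro ⟨c, q, hq⟩ ⟨c', q', hq'⟩ (rfl : q = q')
    obtain rfl := (hA q).unique hq hq'
    rfl
  · intro q
    obtain ⟨c, hc, -⟩ := hA q
    exact ⟨⟨c, q, hc⟩, rfl⟩

theorem coe_xOp_eq_regionTensor {I Q : Type*} [Finite I] [Finite Q] {A : I → Set Q}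
    (hA : IsPartition A) (a : Q → ZMod 2) :
    (xOp a : Op Q) = regionTensor fun c => (xOp fun q : A c => a q : Op (A c)) :=
  qubitTensor_eq_regionTensor hA _

theorem coe_zOp_eq_regionTensor {I Q : Type*} [Finite I] [Finite Q] {A : I → Set Q}
    (hA : IsPartition A) (a : Q → ZMod 2) :
    (zOp a : Op Q) = regionTensor fun c => (zOp fun q : A c => a q : Op (A c)) :=
  qubitTensor_eq_regionTensor hA _

theorem regionTensor_one {I Q : Type*} [Finite I] [Finite Q] {A : I → Set Q}
    (hA : IsPartition A) : regionTensor (fun c => (1 : Op (A c))) = 1 := by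
  rw [← qubitTensor_one, qubitTensor_eq_regionTensor hA]
  simp only [qubitTensor_one]

theorem conjTranspose_regionTensor {I Q' Q : Type*} [Finite I] {B : I → Set Q'} {A : I → Set Q}
    (U : ∀ c, LinOp (B c) (A c)) : (regionTensor U)ᴴ = regionTensor fun c => (U c)ᴴ := by
  have := Fintype.ofFinite I
  ext y x
  rw [Matrix.conjTranspose_apply]
  simp only [regionTensor, Matrix.of_apply, finprod_eq_prod_of_fintype, star_prod]
  rfl

theorem carries_regionTensor {I Q' Q : Type*} [Finite I] [Finite Q'] [Finite Q]
    {B : I → Set Q'} {A : I → Set Q} (hB : IsPartition B) (hA : IsPartition A)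
    {U : ∀ c, LinOp (B c) (A c)} {x z : Q → ZMod 2} {a b : Q' → ZMod 2}
    (h : ∀ c, Carries (U c) ((xOp fun q : A c => x q) * (zOp fun q : A c => z q))
      ((xOp fun q : B c => a q) * (zOp fun q : B c => b q))) :
    Carries (regionTensor U) (xOp x * zOp z) (xOp a * zOp b) := by
  simp only [Carries, Units.val_mul] at h ⊢
  rw [coe_xOp_eq_regionTensor hA, coe_zOp_eq_regionTensor hA, coe_xOp_eq_regionTensor hB,
    coe_zOp_eq_regionTensor hB, regionTensor_mul hA, regionTensor_mul hA, regionTensor_mul hB,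
    regionTensor_mul hB]
  congr 1
  funext c
  exact h c

theorem conjTranspose_regionTensor_mul {I Q' Q : Type*} [Finite I] [Finite Q'] [Finite Q]
    {B : I → Set Q'} {A : I → Set Q} (hB : IsPartition B) (hA : IsPartition A)
    {U : ∀ c, LinOp (B c) (A c)} (h : ∀ c, (U c)ᴴ * U c = 1) :
    (regionTensor U)ᴴ * regionTensor U = 1 := by
  rw [conjTranspose_regionTensor, regionTensor_mul hB]
  simp only [h, regionTensor_one hA]

theorem regionTensor_mul_conjTranspose {I Q' Q : Type*} [Finite I] [Finite Q'] [Finite Q]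
    {B : I → Set Q'} {A : I → Set Q} (hB : IsPartition B) (hA : IsPartition A)
    {U : ∀ c, LinOp (B c) (A c)} (h : ∀ c, U c * (U c)ᴴ = 1) :
    regionTensor U * (regionTensor U)ᴴ = 1 := by
  rw [conjTranspose_regionTensor, regionTensor_mul hA]
  simp only [h, regionTensor_one hB]

theorem carries_glue {I Q' Q : Type*} [Finite I] [Finite Q'] [Finite Q]
    {B : I → Set Q'} {A : I → Set Q} (hB : IsPartition B) (hA : IsPartition A)
    {U : ∀ c, LinOp (B c) (A c)} {x z : Q → ZMod 2} {a b : ∀ c, B c → ZMod 2}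
    (h : ∀ c, Carries (U c) ((xOp fun q : A c => x q) * (zOp fun q : A c => z q))
      (xOp (a c) * zOp (b c))) :
    Carries (regionTensor U) (xOp x * zOp z) (xOp (glue hB a) * zOp (glue hB b)) := by
  refine carries_regionTensor hB hA fun c => ?_
  simp only [glue_apply hB _ c]
  exact h c

theorem mapsPaulis_regionTensor {I Q' Q : Type*} [Finite I] [Finite Q'] [Finite Q]
    {B : I → Set Q'} {A : I → Set Q} (hB : IsPartition B) (hA : IsPartition A)
    {U : ∀ c, LinOp (B c) (A c)} (h : ∀ c, MapsPaulis (U c)) : MapsPaulis (regionTensor U) := by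
  constructor
  · intro x
    choose a b hab using fun c => (h c).1 fun q : A c => x q
    refine ⟨glue hB a, glue hB b, ?_⟩
    rw [← mul_one (xOp x), ← zOp_zero]
    refine carries_glue hB hA fun c => ?_
    rw [show (fun q : A c => (0 : Q → ZMod 2) q) = 0 from rfl, zOp_zero, mul_one]
    exact hab c
  · intro z
    choose a b hab using fun c => (h c).2 fun q : A c => z q
    refine ⟨glue hB a, glue hB b, ?_⟩
    rw [← one_mul (zOp z), ← xOp_zero]
    refine carries_glue hB hA fun c => ?_
    rw [show (fun q : A c => (0 : Q → ZMod 2) q) = 0 from rfl, xOp_zero, one_mul]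
    exact hab c

/-! ### Tensor products of stabilizer groups -/

/-- The part of a basis label on the first of two registers. -/
def Config.left {Q R : Type*} (y : Config (Q ⊕ R)) : Config Q := fun q => y (Sum.inl q)

/-- The part of a basis label on the second of two registers. -/
def Config.right {Q R : Type*} (y : Config (Q ⊕ R)) : Config R := fun r => y (Sum.inr r)

/-- The part of a basis label on the register `j`. -/
def Config.part {J : Type*} {Q : J → Type*} (y : Config (Σ j, Q j)) (j : J) : Config (Q j) :=
  fun q => y ⟨j, q⟩

theorem Config.left_right_eq_iff {Q R : Type*} {y x : Config (Q ⊕ R)} :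
    y.left = x.left ∧ y.right = x.right ↔ y = x := by
  constructor
  · rintro ⟨h₁, h₂⟩
    funext s
    cases s with
    | inl q => exact congrFun h₁ q
    | inr r => exact congrFun h₂ r
  · rintro rfl; exact ⟨rfl, rfl⟩

theorem Config.part_eq_iff {J : Type*} {Q : J → Type*} {y x : Config (Σ j, Q j)} :
    (∀ j, y.part j = x.part j) ↔ y = x := by
  constructor
  · intro h
    funext ⟨j, q⟩
    exact congrFun (h j) q
  · rintro rfl _; rfl

/-- `(P, T) ↦ P ⊗ T`, on operators. -/
def sumTensorOp (Q R : Type*) [Finite Q] [Finite R] : Op Q × Op R →* Op (Q ⊕ R) where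
  toFun P := Matrix.of fun y x => P.1 y.left x.left * P.2 y.right x.right
  map_one' := by
    classical
    ext y x
    simp only [Matrix.of_apply, Prod.fst_one, Prod.snd_one, Matrix.one_apply,
      ← Config.left_right_eq_iff (y := y), ite_and, mul_ite, mul_one, mul_zero]
    split_ifs <;> rfl
  map_mul' P T := by
    ext y x
    simp only [Matrix.of_apply, Prod.fst_mul, Prod.snd_mul, Matrix.mul_apply]
    rw [Finset.sum_mul_sum, ← Fintype.sum_prod_type']
    refine Fintype.sum_equiv (show Config Q × Config R ≃ Config (Q ⊕ R) from
      (Equiv.sumArrowEquivProdArrow Q R (Fin 2)).symm) _ _ fun z => ?_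
    exact mul_mul_mul_comm _ _ _ _

/-- `(P, T) ↦ P ⊗ T`, on invertible operators. -/
def sumTensorHom (Q R : Type*) [Finite Q] [Finite R] :
    (Op Q)ˣ × (Op R)ˣ →* (Op (Q ⊕ R))ˣ :=
  (Units.map (sumTensorOp Q R)).comp MulEquiv.prodUnits.symm.toMonoidHom

/-- `P ↦ ⨂_j P_j`, on operators. -/
def sigmaTensorOp {J : Type*} [Finite J] (Q : J → Type*) [∀ j, Finite (Q j)] :
    (∀ j, Op (Q j)) →* Op (Σ j, Q j) where
  toFun P := Matrix.of fun y x => ∏ᶠ j, P j (y.part j) (x.part j)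
  map_one' := by
    classical
    have := Fintype.ofFinite J
    ext y x
    simp only [Matrix.of_apply, Pi.one_apply, Matrix.one_apply, finprod_eq_prod_of_fintype]
    rw [Finset.prod_ite_zero, Finset.prod_const_one]
    simp only [Finset.mem_univ, forall_const, Config.part_eq_iff]
  map_mul' P T := by
    classical
    have := Fintype.ofFinite J
    ext y x
    simp only [Matrix.of_apply, Pi.mul_apply, Matrix.mul_apply, finprod_eq_prod_of_fintype]
    rw [Finset.prod_univ_sum, Fintype.piFinset_univ]
    refine Fintype.sum_equiv (show (∀ j, Config (Q j)) ≃ Config (Σ j, Q j) from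
      (Equiv.piCurry fun _ _ => Fin 2).symm) _ _ fun z => ?_
    exact Finset.prod_mul_distrib

/-- `P ↦ ⨂_j P_j`, on invertible operators. -/
def sigmaTensorHom {J : Type*} [Finite J] (Q : J → Type*) [∀ j, Finite (Q j)] :
    (∀ j, (Op (Q j))ˣ) →* (Op (Σ j, Q j))ˣ :=
  (Units.map (sigmaTensorOp Q)).comp MulEquiv.piUnits.symm.toMonoidHom

/-- Rewriting the set of tensor products as the image of a subgroup under a homomorphism allows the
two sides of the theorem to be compared on generators; likewise for families below. -/
theorem groupTensor_eq_image {Q R : Type*} [Finite Q] [Finite R]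
    (G : Subgroup (Op Q)ˣ) (H : Subgroup (Op R)ˣ) :
    groupTensor G H =
      Units.val '' ((G.prod H).map (sumTensorHom Q R) : Set (Op (Q ⊕ R))ˣ) := by
  ext M
  constructor
  · rintro ⟨P, hP, T, hT, rfl⟩
    exact ⟨_, ⟨(P, T), ⟨hP, hT⟩, rfl⟩, rfl⟩
  · rintro ⟨_, ⟨⟨P, T⟩, ⟨hP, hT⟩, rfl⟩, rfl⟩
    exact ⟨P, hP, T, hT, rfl⟩

theorem groupTensorFamily_eq_image {J : Type*} [Finite J] {Q : J → Type*} [∀ j, Finite (Q j)]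
    (G : ∀ j, Subgroup (Op (Q j))ˣ) :
    groupTensorFamily G =
      Units.val '' ((Subgroup.pi Set.univ G).map (sigmaTensorHom Q) : Set (Op (Σ j, Q j))ˣ) := by
  ext M
  constructor
  · rintro ⟨P, hP, rfl⟩
    exact ⟨_, ⟨P, fun j _ => hP j, rfl⟩, rfl⟩
  · rintro ⟨_, ⟨P, hP, rfl⟩, rfl⟩
    exact ⟨P, fun j => hP j trivial, rfl⟩

theorem conjBy_image_val {Q' Q : Type*} [Finite Q'] [Finite Q] (U : LinOp Q' Q)
    (h₁ : Uᴴ * U = 1) (h₂ : U * Uᴴ = 1) (G : Subgroup (Op Q)ˣ) :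
    conjBy U (Units.val '' (G : Set (Op Q)ˣ)) =
      Units.val '' (G.map (conjHom U h₁ h₂) : Set (Op Q')ˣ) := by
  rw [conjBy, Subgroup.coe_map, Set.image_image, Set.image_image]
  rfl

theorem qubitTensor_sum {Q R : Type*} [Finite Q] [Finite R]
    (M : Q ⊕ R → Matrix (Fin 2) (Fin 2) ℂ) (y x : Config (Q ⊕ R)) :
    qubitTensor M y x = qubitTensor (fun q => M (Sum.inl q)) y.left x.left *
      qubitTensor (fun r => M (Sum.inr r)) y.right x.right := by
  have := Fintype.ofFinite Q
  have := Fintype.ofFinite R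
  simp only [qubitTensor, Matrix.of_apply]
  rw [finprod_eq_prod_of_fintype, finprod_eq_prod_of_fintype, finprod_eq_prod_of_fintype]
  exact Fintype.prod_sum_type _

theorem sumTensorHom_xOp {Q R : Type*} [Finite Q] [Finite R] (a : Q → ZMod 2) (b : R → ZMod 2) :
    sumTensorHom Q R (xOp a, xOp b) = xOp (Sum.elim a b) := by
  ext y x
  exact (qubitTensor_sum (fun q => sigmaX ^ (Sum.elim a b q).val) y x).symm

theorem sumTensorHom_zOp {Q R : Type*} [Finite Q] [Finite R] (a : Q → ZMod 2) (b : R → ZMod 2) :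
    sumTensorHom Q R (zOp a, zOp b) = zOp (Sum.elim a b) := by
  ext y x
  exact (qubitTensor_sum (fun q => sigmaZ ^ (Sum.elim a b q).val) y x).symm

theorem qubitTensor_sigma {J : Type*} [Finite J] {Q : J → Type*} [∀ j, Finite (Q j)]
    (M : (Σ j, Q j) → Matrix (Fin 2) (Fin 2) ℂ) (y x : Config (Σ j, Q j)) :
    qubitTensor M y x = ∏ᶠ j, qubitTensor (fun q => M ⟨j, q⟩) (y.part j) (x.part j) := by
  have := Fintype.ofFinite J
  have := fun j => Fintype.ofFinite (Q j)
  simp only [qubitTensor, Matrix.of_apply, finprod_eq_prod_of_fintype]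
  exact Fintype.prod_sigma _

theorem sigmaTensorHom_xOp {J : Type*} [Finite J] [DecidableEq J] {Q : J → Type*}
    [∀ j, Finite (Q j)] (j : J) (a : (Σ j, Q j) → ZMod 2) (ha : ∀ q, q.1 ≠ j → a q = 0) :
    sigmaTensorHom Q (Pi.mulSingle j (xOp fun q => a ⟨j, q⟩)) = xOp a := by
  have h : Pi.mulSingle j (xOp fun q => a ⟨j, q⟩) = fun j => (xOp fun q => a ⟨j, q⟩) := by
    funext i
    by_cases hi : i = j
    · subst hi; rw [Pi.mulSingle_eq_same]
    · rw [Pi.mulSingle_eq_of_ne hi, ← xOp_zero]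
      congr 1; funext q; exact (ha ⟨i, q⟩ hi).symm
  rw [h]
  ext y x
  exact (qubitTensor_sigma (fun q => sigmaX ^ (a q).val) y x).symm

theorem sigmaTensorHom_zOp {J : Type*} [Finite J] [DecidableEq J] {Q : J → Type*}
    [∀ j, Finite (Q j)] (j : J) (a : (Σ j, Q j) → ZMod 2) (ha : ∀ q, q.1 ≠ j → a q = 0) :
    sigmaTensorHom Q (Pi.mulSingle j (zOp fun q => a ⟨j, q⟩)) = zOp a := by
  have h : Pi.mulSingle j (zOp fun q => a ⟨j, q⟩) = fun j => (zOp fun q => a ⟨j, q⟩) := by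
    funext i
    by_cases hi : i = j
    · subst hi; rw [Pi.mulSingle_eq_same]
    · rw [Pi.mulSingle_eq_of_ne hi, ← zOp_zero]
      congr 1; funext q; exact (ha ⟨i, q⟩ hi).symm
  rw [h]
  ext y x
  exact (qubitTensor_sigma (fun q => sigmaZ ^ (a q).val) y x).symm

/-! ### A Clifford unitary that trades one `X`-type for a `Z`-type stabilizer -/

theorem Carries.mul {Q' Q : Type*} [Finite Q'] [Finite Q] {U : LinOp Q' Q} {P P' : (Op Q)ˣ}
    {R R' : (Op Q')ˣ} (h : Carries U P R) (h' : Carries U P' R') :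
    Carries U (P * P') (R * R') := by
  simp only [Carries, Units.val_mul] at *
  rw [← Matrix.mul_assoc, h, Matrix.mul_assoc, h', Matrix.mul_assoc]

open Classical in
/-- The operator `|x⟩ ↦ (|N x⟩ + (-1)^(ℓ·x) |N x + η⟩) / √2`, for `N` with values orthogonal to `ζ`
and for `ζ·η = 1`. -/
def foldOp {Q' Q : Type*} [Fintype Q'] [Fintype Q] (N : (Q → ZMod 2) →ₗ[ZMod 2] (Q' → ZMod 2))
    (η ζ : Q' → ZMod 2) (ℓ : Q → ZMod 2) : LinOp Q' Q :=
  Matrix.of fun y x => if y.vec + (ζ ⬝ᵥ y.vec) • η = N x.vec then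
    ((Real.sqrt 2 : ℝ) : ℂ)⁻¹ * binSign ((ζ ⬝ᵥ y.vec) * (ℓ ⬝ᵥ x.vec)) else 0

section FoldOp

variable {Q' Q : Type*} [Fintype Q'] [Fintype Q] {N : (Q → ZMod 2) →ₗ[ZMod 2] (Q' → ZMod 2)}
  {η ζ : Q' → ZMod 2} {ℓ : Q → ZMod 2}

/-- Translating the input by `x` translates both output branches by `N x` and changes the relative
sign of the second by `(-1)^(ℓ·x)`. The second branch is where `ζ·y = 1`, so this sign is the
operator `Z` on `(ℓ·x) ζ`. -/
theorem carries_foldOp_xOp (hN : ∀ x, ζ ⬝ᵥ N x = 0) (x : Q → ZMod 2) :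
    Carries (foldOp N η ζ ℓ) (xOp x) (xOp (N x) * zOp ((ℓ ⬝ᵥ x) • ζ)) := by
  ext y z
  rw [Units.val_mul, Matrix.mul_assoc, mul_xOp_apply, xOp_mul_apply, zOp_mul_apply]
  simp only [foldOp, Matrix.of_apply, Equiv.apply_symm_apply, dotProduct_add, hN, add_zero,
    map_add, smul_dotProduct]
  have h : y.vec + (ζ ⬝ᵥ y.vec) • η = N z.vec + N x ↔
      y.vec + N x + (ζ ⬝ᵥ y.vec) • η = N z.vec := by
    rw [← add_left_inj (N x), add_assoc (N z.vec), zmodTwo_add_self, add_zero, add_right_comm]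
  simp only [h, mul_ite, mul_zero]
  refine if_congr Iff.rfl ?_ rfl
  rw [mul_add, binSign_add, smul_eq_mul, mul_comm (ℓ ⬝ᵥ x), smul_zero, add_zero]
  ring

/-- On the support `N x = y + (ζ·y) η`, whence `T t · x = t · N x = (t + (t·η) ζ) · y`. -/
theorem carries_foldOp_zOp {T : (Q' → ZMod 2) → (Q → ZMod 2)}
    (hT : ∀ t x, T t ⬝ᵥ x = t ⬝ᵥ N x) (t : Q' → ZMod 2) :
    Carries (foldOp N η ζ ℓ) (zOp (T t)) (zOp (t + (t ⬝ᵥ η) • ζ)) := by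
  ext y z
  rw [mul_zOp_apply, zOp_mul_apply]
  simp only [foldOp, Matrix.of_apply, ite_mul, zero_mul, mul_ite, mul_zero]
  split_ifs with h
  · rw [hT, ← h, mul_comm]
    simp only [add_dotProduct, dotProduct_add, smul_dotProduct, dotProduct_smul, smul_eq_mul]
    rw [mul_comm (ζ ⬝ᵥ y.vec) (t ⬝ᵥ η)]
  · rfl

/-- Adding `η` exchanges the two branches, which differ by the sign `(-1)^(ℓ·x)`. -/
theorem carries_foldOp_zOp_right (hη : ζ ⬝ᵥ η = 1) :
    Carries (foldOp N η ζ ℓ) (zOp ℓ) (xOp η) := by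
  ext y z
  rw [mul_zOp_apply, xOp_mul_apply]
  simp only [foldOp, Matrix.of_apply, ite_mul, zero_mul, Equiv.apply_symm_apply, dotProduct_add,
    hη]
  have h : y.vec + η + (ζ ⬝ᵥ y.vec + 1) • η = y.vec + (ζ ⬝ᵥ y.vec) • η := by
    rw [add_smul, one_smul, add_add_add_comm, zmodTwo_add_self, add_zero]
  rw [h]
  refine if_congr Iff.rfl ?_ rfl
  rw [add_mul, one_mul, binSign_add, mul_assoc]

/-- The branches `N x` and `N x + η` are told apart by `ζ`, so two columns overlap only if `N`
agrees on them, that is, for `x' = x` or `x' = x + κ`. In the second case the two branches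
contribute with opposite signs because `ℓ·κ = 1`. -/
theorem conjTranspose_foldOp_mul (hN : ∀ x, ζ ⬝ᵥ N x = 0) (hη : ζ ⬝ᵥ η = 1) {κ : Q → ZMod 2}
    (hκ : ℓ ⬝ᵥ κ = 1) (hker : ∀ x, N x = 0 → x = 0 ∨ x = κ) :
    (foldOp N η ζ ℓ)ᴴ * foldOp N η ζ ℓ = 1 := by
  classical
  ext x' x
  rw [Matrix.mul_apply, Matrix.one_apply]
  have hs : ((Real.sqrt 2 : ℝ) : ℂ)⁻¹ * ((Real.sqrt 2 : ℝ) : ℂ)⁻¹ = 2⁻¹ := by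
    rw [← mul_inv, ← Complex.ofReal_mul, Real.mul_self_sqrt (by norm_num)]; norm_num
  have hstar : ∀ s, star (binSign s) = binSign s := by
    intro s; unfold binSign; split_ifs <;> simp
  have hstars : star (((Real.sqrt 2 : ℝ) : ℂ)⁻¹) = ((Real.sqrt 2 : ℝ) : ℂ)⁻¹ := by
    simp [← Complex.ofReal_inv]
  have hterm : ∀ y : Config Q', (foldOp N η ζ ℓ)ᴴ x' y * foldOp N η ζ ℓ y x =
      if y.vec + (ζ ⬝ᵥ y.vec) • η = N x.vec then
        if N x.vec = N x'.vec then
          2⁻¹ * binSign ((ζ ⬝ᵥ y.vec) * (ℓ ⬝ᵥ (x.vec + x'.vec))) else 0 else 0 := by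
    intro y
    simp only [Matrix.conjTranspose_apply, foldOp, Matrix.of_apply]
    by_cases h : y.vec + (ζ ⬝ᵥ y.vec) • η = N x.vec
    · simp only [h, if_true]
      by_cases h' : N x.vec = N x'.vec
      · simp only [h', if_true]
        rw [star_mul', hstar, hstars, dotProduct_add, mul_add, binSign_add, ← hs]
        ring
      · simp [h']
    · simp [h]
  -- The left side projects `y` along `η` onto the vectors orthogonal to `ζ`; a fibre of the
  -- projection has two points.
  have hmem : ∀ y : Config Q', y.vec + (ζ ⬝ᵥ y.vec) • η = N x.vec ↔
      y = Config.vec.symm (N x.vec) ∨ y = Config.vec.symm (N x.vec + η) := by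
    intro y
    rw [Equiv.eq_symm_apply, Equiv.eq_symm_apply]
    constructor
    · intro h
      have h2 : ζ ⬝ᵥ y.vec = 0 ∨ ζ ⬝ᵥ y.vec = 1 := by
        generalize ζ ⬝ᵥ y.vec = s; revert s; decide
      rcases h2 with h2 | h2 <;> rw [h2] at h
      · left; simpa using h
      · right; rw [← h, one_smul, add_assoc, zmodTwo_add_self, add_zero]
    · rintro (h | h) <;> rw [h]
      · simp [hN]
      · simp [dotProduct_add, hN, hη, add_assoc, zmodTwo_add_self]
  have hη0 : η ≠ 0 := by rintro rfl; simp at hη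
  simp only [hterm]
  rw [← Finset.sum_filter]
  have hf : (Finset.univ.filter fun y : Config Q' => y.vec + (ζ ⬝ᵥ y.vec) • η = N x.vec) =
      {Config.vec.symm (N x.vec), Config.vec.symm (N x.vec + η)} := by
    ext y; simp [hmem]
  rw [hf, Finset.sum_pair (by simpa using hη0)]
  simp only [Equiv.apply_symm_apply, dotProduct_add, hN, hη, zero_mul, zero_add, one_mul,
    binSign_zero]
  by_cases h : N x.vec = N x'.vec
  · simp only [h, if_true]
    have hx : N (x.vec + x'.vec) = 0 := by rw [map_add, h, zmodTwo_add_self]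
    rw [← dotProduct_add]
    rcases hker _ hx with h0 | h0
    · have : x' = x := by
        apply Config.vec.injective
        rw [← add_zero x'.vec, ← h0, add_comm x.vec, ← add_assoc, zmodTwo_add_self, zero_add]
      rw [if_pos this, h0, dotProduct_zero, binSign_zero]; norm_num
    · have : x' ≠ x := by
        rintro rfl
        rw [zmodTwo_add_self] at h0
        rw [← h0, dotProduct_zero] at hκ
        exact zero_ne_one hκ
      rw [if_neg this, h0, hκ, binSign_one]; norm_num
  · have : x' ≠ x := by rintro rfl; exact h rfl
    simp [h, this]

theorem foldOp_mul_conjTranspose (hN : ∀ x, ζ ⬝ᵥ N x = 0) (hη : ζ ⬝ᵥ η = 1) {κ : Q → ZMod 2}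
    (hκ : ℓ ⬝ᵥ κ = 1) (hker : ∀ x, N x = 0 → x = 0 ∨ x = κ)
    (hcard : Fintype.card Q = Fintype.card Q') :
    foldOp N η ζ ℓ * (foldOp N η ζ ℓ)ᴴ = 1 := by
  have e : Config Q ≃ Config Q' :=
    show (Q → Fin 2) ≃ (Q' → Fin 2) from (Fintype.equivOfCardEq hcard).arrowCongr (Equiv.refl _)
  exact (Matrix.mul_eq_one_comm_of_equiv e).1 (conjTranspose_foldOp_mul hN hη hκ hker)

end FoldOp

theorem exists_dotProduct_eq {E : Type*} [Fintype E] (f : (E → ZMod 2) →ₗ[ZMod 2] ZMod 2) :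
    ∃ η, ∀ t, f t = t ⬝ᵥ η := by
  classical
  refine ⟨fun e => f (Pi.single e 1), fun t => ?_⟩
  rw [LinearMap.pi_apply_eq_sum_univ f t]
  simp only [dotProduct, smul_eq_mul]
  refine Finset.sum_congr rfl fun e _ => ?_
  congr 2
  funext e'
  simp [Pi.single_apply, eq_comm]

theorem exists_transpose {E Q : Type*} [Fintype E] [Fintype Q]
    (T : (E → ZMod 2) →ₗ[ZMod 2] (Q → ZMod 2)) :
    ∃ N : (Q → ZMod 2) →ₗ[ZMod 2] (E → ZMod 2), ∀ t x, T t ⬝ᵥ x = t ⬝ᵥ N x := by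
  classical
  refine ⟨(LinearMap.toMatrix' T)ᵀ.mulVecLin, fun t x => ?_⟩
  rw [Matrix.mulVecLin_apply, Matrix.mulVec_transpose, dotProduct_comm t, ← Matrix.dotProduct_mulVec,
    LinearMap.toMatrix'_mulVec, dotProduct_comm]

/-- The image of `M` consists exactly of the vectors of even weight, which have codimension 1; the
rest is rank and nullity. -/
theorem finrank_ker_incidence {V E : Type*} [Fintype V] [Fintype E] (M : Matrix V E (ZMod 2))
    (v₀ : V) (hcol : ∀ e, ∑ v, M v e = 0)
    (heven : ∀ s : V → ZMod 2, ∑ v, s v = 0 → ∃ t, M *ᵥ t = s) :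
    Module.finrank (ZMod 2) (LinearMap.ker M.mulVecLin) + Fintype.card V = Fintype.card E + 1 := by
  classical
  let sumMap : (V → ZMod 2) →ₗ[ZMod 2] ZMod 2 := ∑ v, LinearMap.proj v
  have hsum : ∀ s, sumMap s = ∑ v, s v := fun s => by simp [sumMap]
  have hrange : LinearMap.range M.mulVecLin = LinearMap.ker sumMap := by
    ext s
    rw [LinearMap.mem_range, LinearMap.mem_ker, hsum]
    refine ⟨?_, heven s⟩
    rintro ⟨t, rfl⟩
    simp only [Matrix.mulVecLin_apply, Matrix.mulVec, dotProduct]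
    rw [Finset.sum_comm]
    simp [← Finset.sum_mul, hcol]
  have hsurj : LinearMap.range sumMap = ⊤ := by
    rw [LinearMap.range_eq_top]
    intro r
    exact ⟨Pi.single v₀ r, by simp [hsum]⟩
  have h1 := M.mulVecLin.finrank_range_add_finrank_ker
  have h2 := sumMap.finrank_range_add_finrank_ker
  rw [hsurj, finrank_top, Module.finrank_self, Module.finrank_fintype_fun_eq_card] at h2
  rw [hrange, Module.finrank_fintype_fun_eq_card] at h1
  omega

/-- The Clifford unitary attached to a connected graph with incidence matrix `M`: it trades the
qubits on the vertices and enough ancilla qubits for qubits on the edges. -/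
theorem exists_clifford_of_incidence {V A E Q : Type*} [Fintype V] [Fintype A] [Fintype E]
    [Fintype Q] (σ : Q ≃ V ⊕ A) (M : Matrix V E (ZMod 2)) (v₀ : V)
    (hcol : ∀ e, ∑ v, M v e = 0)
    (heven : ∀ s : V → ZMod 2, ∑ v, s v = 0 → ∃ t, M *ᵥ t = s)
    (hcard : Fintype.card E = Fintype.card V + Fintype.card A) :
    ∃ U : LinOp E Q, Uᴴ * U = 1 ∧ U * Uᴴ = 1 ∧ MapsPaulis U ∧
      (∀ w, ∃ k, M *ᵥ k = 0 ∧
        Carries U (xOp (Sum.elim w 0 ∘ σ)) (xOp (w ᵥ* M) * zOp k)) ∧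
      (∀ t b, ∃ k, M *ᵥ k = 0 ∧
        Carries U (zOp (Sum.elim (M *ᵥ t) b ∘ σ)) (zOp (t + k))) ∧
      ∀ k, M *ᵥ k = 0 → ∃ (α : ZMod 2) (b : A → ZMod 2),
        Carries U (xOp (Sum.elim (fun _ => α) 0 ∘ σ) * zOp (Sum.elim 0 b ∘ σ)) (zOp k) := by
  classical
  have hfin := finrank_ker_incidence M v₀ hcol heven
  -- The cycle space has one dimension per ancilla and one more, reserved for `X` on all vertices.
  have hdim : Module.finrank (ZMod 2) ((A → ZMod 2) × ZMod 2) =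
      Module.finrank (ZMod 2) (LinearMap.ker M.mulVecLin) := by
    rw [Module.finrank_prod, Module.finrank_fintype_fun_eq_card, Module.finrank_self]
    omega
  let θ' := LinearEquiv.ofFinrankEq _ _ hdim
  let θ : ((A → ZMod 2) × ZMod 2) →ₗ[ZMod 2] (E → ZMod 2) :=
    (LinearMap.ker M.mulVecLin).subtype ∘ₗ θ'.toLinearMap
  have hθ : ∀ p, M *ᵥ θ p = 0 := fun p => (θ' p).2
  have hθsurj : ∀ k, M *ᵥ k = 0 → ∃ p, θ p = k := fun k hk =>
    ⟨θ'.symm ⟨k, hk⟩, by simp [θ]⟩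
  have hθinj : LinearMap.ker θ = ⊥ := by
    rw [LinearMap.ker_eq_bot]
    exact Subtype.val_injective.comp θ'.injective
  obtain ⟨π, hπ⟩ := θ.exists_leftInverse_of_injective hθinj
  have hπθ : ∀ p, π (θ p) = p := fun p => LinearMap.congr_fun hπ p
  -- `T` pulls `Z`-vectors on edges back to vertices and ancillas, reading the ancilla part from the
  -- coordinates of the cycle space. The last coordinate is dropped, so `T` kills `ζ = θ (0, 1)`;
  -- its transpose `N` moves the `X`-vectors.
  let T : (E → ZMod 2) →ₗ[ZMod 2] (Q → ZMod 2) :=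
    { toFun := fun t => Sum.elim (M *ᵥ t) (π t).1 ∘ σ
      map_add' := fun t t' => by
        funext q
        simp only [Function.comp_apply, Pi.add_apply]
        cases σ q <;> simp [Matrix.mulVec_add]
      map_smul' := fun r t => by
        funext q
        simp only [Function.comp_apply, Pi.smul_apply]
        cases σ q <;> simp [Matrix.mulVec_smul] }
  have hTdot : ∀ t w b, T t ⬝ᵥ (Sum.elim w b ∘ σ) = M *ᵥ t ⬝ᵥ w + (π t).1 ⬝ᵥ b := by
    intro t w b
    rw [← sumElim_dotProduct_sumElim]
    exact σ.sum_comp fun s => Sum.elim (M *ᵥ t) (π t).1 s * Sum.elim w b s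
  obtain ⟨N, hTN⟩ := exists_transpose T
  obtain ⟨η, hη⟩ := exists_dotProduct_eq (LinearMap.snd (ZMod 2) _ _ ∘ₗ π)
  replace hη : ∀ t, (π t).2 = t ⬝ᵥ η := hη
  have hsplit : ∀ x : Q → ZMod 2, ∃ w b, x = Sum.elim w b ∘ σ := fun x =>
    ⟨fun v => x (σ.symm (Sum.inl v)), fun a => x (σ.symm (Sum.inr a)), by
      funext q
      obtain ⟨s, rfl⟩ := σ.symm.surjective q
      cases s <;> simp⟩
  set ζ := θ (0, 1) with hζ
  have hTζ : T ζ = 0 := by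
    funext q
    change Sum.elim (M *ᵥ ζ) (π ζ).1 (σ q) = 0
    rw [hζ, hθ, hπθ]
    cases σ q <;> rfl
  have hNζ : ∀ x, ζ ⬝ᵥ N x = 0 := fun x => by rw [← hTN, hTζ, zero_dotProduct]
  have hζη : ζ ⬝ᵥ η = 1 := by rw [← hη, hζ, hπθ]
  have hNw : ∀ w, N (Sum.elim w 0 ∘ σ) = w ᵥ* M := by
    intro w
    refine dotProduct_eq _ _ fun t => ?_
    rw [dotProduct_comm, ← hTN, hTdot, dotProduct_zero, add_zero, dotProduct_comm,
      Matrix.dotProduct_mulVec]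
  -- Any odd vertex vector would do: it pairs to 1 with the all-ones vector `κ` and completes the
  -- range of `T` to the whole space.
  let ℓ : Q → ZMod 2 := Sum.elim (Pi.single v₀ 1) 0 ∘ σ
  have hℓ : ∀ w b, ℓ ⬝ᵥ (Sum.elim w b ∘ σ) = w v₀ := by
    intro w b
    have : ℓ ⬝ᵥ (Sum.elim w b ∘ σ) = Sum.elim (Pi.single v₀ 1) 0 ⬝ᵥ Sum.elim w b :=
      σ.sum_comp fun s => Sum.elim (Pi.single v₀ 1) (0 : A → ZMod 2) s * Sum.elim w b s
    rw [this, sumElim_dotProduct_sumElim]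
    simp
  have hconst : ∀ α : ZMod 2, (fun _ : V => α) ᵥ* M = 0 := by
    intro α
    funext e
    simp only [Matrix.vecMul, dotProduct, ← Finset.mul_sum, hcol, mul_zero, Pi.zero_apply]
  let κ : Q → ZMod 2 := Sum.elim (fun _ => 1) 0 ∘ σ
  have hκ : ℓ ⬝ᵥ κ = 1 := hℓ _ _
  have hrange : ∀ t b, ∃ k, M *ᵥ k = 0 ∧ T (t + k) = Sum.elim (M *ᵥ t) b ∘ σ := by
    intro t b
    -- A cycle corrects the ancilla part without touching the vertex part.
    refine ⟨θ (b - (π t).1, 0), hθ _, ?_⟩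
    change Sum.elim (M *ᵥ (t + _)) (π (t + _)).1 ∘ σ = _
    rw [Matrix.mulVec_add, hθ, add_zero, map_add, hπθ]
    simp
  have hker : ∀ x, N x = 0 → x = 0 ∨ x = κ := by
    intro x hx
    obtain ⟨w, b, rfl⟩ := hsplit x
    -- A vector killed by `N` is orthogonal to the range of `T`, which contains every pair of an
    -- even vertex vector and an ancilla vector. So its ancilla part is 0 and its vertex part is
    -- constant.
    have horth : ∀ s : V → ZMod 2, ∑ v, s v = 0 → ∀ b', s ⬝ᵥ w + b' ⬝ᵥ b = 0 := by
      intro s hs b'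
      obtain ⟨t, rfl⟩ := heven s hs
      obtain ⟨k, hk, hT⟩ := hrange t b'
      have h1 := hTN (t + k) (Sum.elim w b ∘ σ)
      rw [hx, dotProduct_zero, hTdot] at h1
      have h2 : (π (t + k)).1 = b' := by
        funext a
        have := congrFun hT (σ.symm (Sum.inr a))
        simpa [T] using this
      rwa [Matrix.mulVec_add, hk, add_zero, h2] at h1
    have hb : b = 0 := by
      funext a
      have := horth 0 (by simp) (Pi.single a 1)
      simpa using this
    have hw : ∀ v, w v = w v₀ := by
      intro v
      have := horth (Pi.single v 1 - Pi.single v₀ 1) (by simp) 0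
      simpa [sub_dotProduct, sub_eq_zero] using this
    have h2 : w v₀ = 0 ∨ w v₀ = 1 := by generalize w v₀ = s; revert s; decide
    have hw' : w = fun _ => w v₀ := funext hw
    rcases h2 with h2 | h2 <;> rw [h2] at hw' <;> rw [hw', hb]
    · left
      funext q
      change Sum.elim _ _ (σ q) = 0
      cases σ q <;> rfl
    · right; rfl
  have hX := carries_foldOp_xOp (N := N) (η := η) (ζ := ζ) (ℓ := ℓ) hNζ
  have hZ := carries_foldOp_zOp (N := N) (η := η) (ζ := ζ) (ℓ := ℓ) (T := T) hTN
  have hZ' := carries_foldOp_zOp_right (N := N) (η := η) (ζ := ζ) (ℓ := ℓ) hζη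
  refine ⟨foldOp N η ζ ℓ, conjTranspose_foldOp_mul hNζ hζη hκ hker,
    foldOp_mul_conjTranspose hNζ hζη hκ hker ?_, ⟨fun x => ⟨_, _, hX x⟩, fun z => ?_⟩, ?_, ?_, ?_⟩
  · rw [Fintype.card_congr σ, Fintype.card_sum, hcard]
  · obtain ⟨w, b, rfl⟩ := hsplit z
    by_cases hs : ∑ v, w v = 0
    · obtain ⟨t, rfl⟩ := heven w hs
      obtain ⟨k, -, hT⟩ := hrange t b
      refine ⟨0, t + k + ((t + k) ⬝ᵥ η) • ζ, ?_⟩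
      rw [← hT, xOp_zero, one_mul]
      exact hZ _
    -- An odd vector becomes even after subtracting the vertex `v₀`, whose `Z` is carried to `X` on
    -- `η`.
    · have hs' : ∑ v, (w - Pi.single v₀ 1 : V → ZMod 2) v = 0 := by
        have : ∀ s : ZMod 2, s ≠ 0 → s - 1 = 0 := by decide
        simpa using this _ hs
      obtain ⟨t, ht⟩ := heven _ hs'
      obtain ⟨k, -, hT⟩ := hrange t b
      refine ⟨η, t + k + ((t + k) ⬝ᵥ η) • ζ, ?_⟩
      have : Sum.elim w b ∘ σ = ℓ + T (t + k) := by
        rw [hT, ht]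
        funext q
        simp only [Function.comp_apply, Pi.add_apply, ℓ]
        cases σ q <;> simp
      rw [this, zOp_add]
      exact hZ'.mul (hZ _)
  · intro w
    refine ⟨(w v₀) • ζ, by rw [Matrix.mulVec_smul, hθ, smul_zero], ?_⟩
    have := hX (Sum.elim w 0 ∘ σ)
    rwa [hNw, hℓ] at this
  · intro t b
    obtain ⟨k, hk, hT⟩ := hrange t b
    refine ⟨k + ((t + k) ⬝ᵥ η) • ζ, ?_, ?_⟩
    · rw [Matrix.mulVec_add, Matrix.mulVec_smul, hk, hθ, smul_zero, add_zero]
    · rw [← hT, ← add_assoc]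
      exact hZ _
  · intro k hk
    obtain ⟨⟨b, α⟩, rfl⟩ := hθsurj k hk
    refine ⟨α, b, ?_⟩
    have h1 := hX (Sum.elim (fun _ => α) 0 ∘ σ)
    have h2 := hZ (θ (b, 0))
    rw [hNw, hℓ, hconst, xOp_zero, one_mul] at h1
    rw [← hη, hπθ, zero_smul, add_zero] at h2
    have h3 : T (θ (b, 0)) = Sum.elim (0 : V → ZMod 2) b ∘ σ := by
      change Sum.elim (M *ᵥ _) (π _).1 ∘ σ = _
      rw [hθ, hπθ]
    have h4 : θ (b, α) = α • ζ + θ (b, 0) := by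
      -- The summand `α • ζ` comes from `X` on the constant vertex vector, and `θ (b, 0)` from the
      -- ancillas.
      rw [hζ, ← map_smul, ← map_add]; simp
    rw [h4, zOp_add, ← h3]
    exact h1.mul h2

/-! ### Gluing the Clifford unitaries of the components of a graph -/

section Components

variable {I V A E : Type*}
  {rV : V → I} {rA : A → I} {rE : E → I} {RS : I → Set (V ⊕ A)} {RT : I → Set E}
  {M : Matrix V E (ZMod 2)}

theorem isPartition_of_mem_iff {I Q : Type*} {R : I → Set Q} {r : Q → I}
    (h : ∀ c q, q ∈ R c ↔ r q = c) : IsPartition R :=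
  fun q => ⟨r q, (h _ _).2 rfl, fun _ hc => ((h _ _).1 hc).symm⟩

/-- A region, split into its vertices and its ancillas. -/
def regionEquiv (hRS : ∀ c q, q ∈ RS c ↔ Sum.elim rV rA q = c) (c : I) :
    RS c ≃ {v // rV v = c} ⊕ {a // rA a = c} where
  toFun
    | ⟨Sum.inl v, h⟩ => Sum.inl ⟨v, (hRS c _).1 h⟩
    | ⟨Sum.inr a, h⟩ => Sum.inr ⟨a, (hRS c _).1 h⟩
  invFun
    | Sum.inl v => ⟨Sum.inl v.1, (hRS c _).2 v.2⟩
    | Sum.inr a => ⟨Sum.inr a.1, (hRS c _).2 a.2⟩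
  left_inv := by rintro ⟨_ | _, _⟩ <;> rfl
  right_inv := by rintro (_ | _) <;> rfl

theorem elim_comp_regionEquiv (hRS : ∀ c q, q ∈ RS c ↔ Sum.elim rV rA q = c) (c : I)
    {w : V → ZMod 2} {b : A → ZMod 2} {w' : {v // rV v = c} → ZMod 2}
    {b' : {a // rA a = c} → ZMod 2} (hw : ∀ v, w v.1 = w' v) (hb : ∀ a, b a.1 = b' a) :
    (fun q : RS c => Sum.elim w b q.1) = Sum.elim w' b' ∘ regionEquiv hRS c := by
  funext ⟨q, hq⟩
  cases q with
  | inl v => exact hw ⟨v, (hRS c _).1 hq⟩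
  | inr a => exact hb ⟨a, (hRS c _).1 hq⟩

-- By `hM` the matrix is block diagonal with respect to the regions, so products with it can be
-- computed region by region.
open Classical in
theorem mulVec_eq_submatrix [Fintype E] (hM : ∀ v e, M v e ≠ 0 → rV v = rE e)
    (hRT : ∀ c e, e ∈ RT c ↔ rE e = c) (c : I) (t : E → ZMod 2) (v : {v // rV v = c}) :
    (M *ᵥ t) v.1 = ((M.submatrix Subtype.val Subtype.val : Matrix _ (RT c) _) *ᵥ
      (fun e : RT c => t e)) v := by
  simp only [Matrix.mulVec, dotProduct, Matrix.submatrix_apply]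
  rw [← Finset.sum_subset (Finset.subset_univ (Finset.univ.filter (· ∈ RT c))),
    Finset.sum_subtype (p := (· ∈ RT c))]
  · simp
  · intro e _ he
    have : ¬ M v.1 e ≠ 0 := fun h => he <| by
      simp [hRT, ← hM _ _ h, v.2]
    rw [not_not.1 this, zero_mul]

open Classical in
theorem vecMul_eq_submatrix [Fintype V] (hM : ∀ v e, M v e ≠ 0 → rV v = rE e)
    (hRT : ∀ c e, e ∈ RT c ↔ rE e = c) (c : I) (w : V → ZMod 2) (e : RT c) :
    (w ᵥ* M) e.1 = ((fun v : {v // rV v = c} => w v) ᵥ*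
      (M.submatrix Subtype.val Subtype.val : Matrix _ (RT c) _)) e := by
  simp only [Matrix.vecMul, dotProduct, Matrix.submatrix_apply]
  rw [← Finset.sum_subset (Finset.subset_univ (Finset.univ.filter (rV · = c))),
    Finset.sum_subtype (p := (rV · = c))]
  · simp
  · intro v _ hv
    have : ¬ M v e.1 ≠ 0 := fun h => hv <| by
      simp [hM _ _ h, (hRT c _).1 e.2]
    rw [not_not.1 this, mul_zero]

/-- Each block supplies its own unitary and its own trade of `X` on all its vertices; hence the
coefficient `α` now depends on the region. -/
theorem exists_clifford_of_components [Finite I] [Fintype V] [Fintype A] [Fintype E]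
    (hM : ∀ v e, M v e ≠ 0 → rV v = rE e)
    (hRS : ∀ c q, q ∈ RS c ↔ Sum.elim rV rA q = c) (hRT : ∀ c e, e ∈ RT c ↔ rE e = c)
    (hne : ∀ c, ∃ v, rV v = c) (hcol : ∀ e, ∑ v, M v e = 0)
    (heven : ∀ c (s : V → ZMod 2), (∀ v, s v ≠ 0 → rV v = c) → ∑ v, s v = 0 → ∃ t, M *ᵥ t = s)
    (hcard : ∀ c, Nat.card {e // rE e = c} =
      Nat.card {v // rV v = c} + Nat.card {a // rA a = c}) :
    ∃ U : ∀ c, LinOp (RT c) (RS c), (∀ c, IsClifford (U c)) ∧ IsClifford (regionTensor U) ∧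
      (∀ w, ∃ k, M *ᵥ k = 0 ∧
        Carries (regionTensor U) (xOp (Sum.elim w 0)) (xOp (w ᵥ* M) * zOp k)) ∧
      (∀ t b, ∃ k, M *ᵥ k = 0 ∧
        Carries (regionTensor U) (zOp (Sum.elim (M *ᵥ t) b)) (zOp (t + k))) ∧
      ∀ k, M *ᵥ k = 0 → ∃ (α : I → ZMod 2) (b : A → ZMod 2),
        Carries (regionTensor U) (xOp (Sum.elim (fun v => α (rV v)) 0) * zOp (Sum.elim 0 b))
          (zOp k) := by
  classical
  have hPS : IsPartition RS := isPartition_of_mem_iff hRS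
  have hPT : IsPartition RT := isPartition_of_mem_iff hRT
  have hlocal := fun c => exists_clifford_of_incidence (regionEquiv hRS c)
    (M.submatrix Subtype.val Subtype.val : Matrix {v // rV v = c} (RT c) (ZMod 2))
    ⟨(hne c).choose, (hne c).choose_spec⟩
    (by
      intro e
      have h := hcol e.1
      have h' := vecMul_eq_submatrix hM hRT c 1 e
      simp only [Matrix.vecMul, dotProduct, Pi.one_apply, one_mul, Matrix.submatrix_apply] at h' ⊢
      rw [← h', h])
    (by
      intro s hs
      obtain ⟨t, ht⟩ := heven c (fun v => if h : rV v = c then s ⟨v, h⟩ else 0)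
        (fun v hv => by
          by_contra h
          exact hv (dif_neg h))
        (by
          rw [← Finset.sum_subset (Finset.subset_univ (Finset.univ.filter (rV · = c))),
            Finset.sum_subtype (p := (rV · = c))]
          · rw [← hs]
            refine Finset.sum_congr rfl fun v _ => ?_
            exact dif_pos v.2
          · simp
          · intro v _ hv
            exact dif_neg (by simpa using hv))
      refine ⟨fun e => t e, ?_⟩
      funext v
      rw [← mulVec_eq_submatrix hM hRT, ht]
      exact dif_pos v.2)
    (by
      have h := hcard c
      simp only [Nat.card_eq_fintype_card] at h
      rw [← h]
      exact Fintype.card_congr (Equiv.subtypeEquivRight fun e => hRT c e))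
  choose U h₁ h₂ hP hX hZ hK using hlocal
  have hker : ∀ k : E → ZMod 2, (∀ c, (M.submatrix Subtype.val Subtype.val :
      Matrix {v // rV v = c} (RT c) (ZMod 2)) *ᵥ (fun e : RT c => k e) = 0) → M *ᵥ k = 0 := by
    intro k h
    funext v
    have := mulVec_eq_submatrix hM hRT (rV v) k ⟨v, rfl⟩
    rw [h] at this
    exact this
  refine ⟨U, fun c => isClifford_of_mapsPaulis (h₁ c) (h₂ c) (hP c),
    isClifford_of_mapsPaulis (conjTranspose_regionTensor_mul hPT hPS h₁)
      (regionTensor_mul_conjTranspose hPT hPS h₂) (mapsPaulis_regionTensor hPT hPS hP),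
    ?_, ?_, ?_⟩
  · intro w
    choose k hk hU using fun c => hX c fun v => w v
    refine ⟨glue hPT k, hker _ fun c => ?_, ?_⟩
    · simp only [glue_apply hPT _ c]
      exact hk c
    · rw [← mul_one (xOp _), ← zOp_zero]
      refine carries_regionTensor hPT hPS fun c => ?_
      rw [show (fun q : RS c => (0 : V ⊕ A → ZMod 2) q) = 0 from rfl, zOp_zero, mul_one,
        elim_comp_regionEquiv hRS c (w' := fun v => w v) (b' := 0) (fun _ => rfl) fun _ => rfl]
      simp only [glue_apply hPT _ c, vecMul_eq_submatrix hM hRT c]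
      exact hU c
  · intro t b
    choose k hk hU using fun c => hZ c (fun e => t e) fun a => b a
    refine ⟨glue hPT k, hker _ fun c => ?_, ?_⟩
    · simp only [glue_apply hPT _ c]
      exact hk c
    -- Trivial `X`-factors are inserted because `carries_regionTensor` speaks of products of an `X`-
    -- and a `Z`-operator.
    · rw [← one_mul (zOp (Sum.elim _ _)), ← xOp_zero, ← one_mul (zOp (t + _)), ← xOp_zero]
      refine carries_regionTensor hPT hPS fun c => ?_
      rw [show (fun q : RS c => (0 : V ⊕ A → ZMod 2) q) = 0 from rfl, xOp_zero, one_mul,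
        show (fun q : RT c => (0 : E → ZMod 2) q) = 0 from rfl, xOp_zero, one_mul,
        elim_comp_regionEquiv hRS c (mulVec_eq_submatrix hM hRT c t) (b' := fun a => b a)
          fun _ => rfl]
      simp only [Pi.add_apply, glue_apply hPT _ c]
      exact hU c
  · intro k hk
    choose α b hU using fun c => hK c (fun e => k e) (by
      funext v
      rw [← mulVec_eq_submatrix hM hRT, hk]
      rfl)
    refine ⟨α, fun a => b (rA a) ⟨a, rfl⟩, ?_⟩
    rw [← one_mul (zOp k), ← xOp_zero]
    refine carries_regionTensor hPT hPS fun c => ?_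
    rw [show (fun q : RT c => (0 : E → ZMod 2) q) = 0 from rfl, xOp_zero, one_mul,
      elim_comp_regionEquiv hRS c (w' := fun _ => α c) (b' := 0) (fun v => by rw [v.2])
        fun _ => rfl,
      elim_comp_regionEquiv hRS c (w' := 0) (b' := b c) (fun _ => rfl)
        (by rintro ⟨a, rfl⟩; rfl)]
    exact hU c

end Components

/-! ### Colors of cells -/

namespace ColoredLattice

variable {Cell : Type*} [PartialOrder Cell] {d : ℕ} (L : ColoredLattice Cell d)

/-- The `d`-cells at `v` are the complements of single edges. Any two of them share the `(d-1)`-cell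
spanned by the remaining edges, so their `d + 1` colors are distinct and exhaust all colors. A cell
lies in exactly those `d`-cells whose omitted edge it does not use. -/
theorem exists_chart (hd : 2 ≤ d) {v : Cell} (hv : L.dim v = 0) :
    ∃ (φ : Set.Ici v ≃o {T : Finset (Fin (d + 1)) // T ≠ Finset.univ})
      (ε : Equiv.Perm (Fin (d + 1))), ∀ x : Set.Ici v, L.dim x = (φ x).1.card ∧
        ∀ j, ε j ∈ L.colorsOf x ↔ j ∉ (φ x).1 := by
  obtain ⟨φ, hφ⟩ := L.valence v hv
  let S : Fin (d + 1) → {T : Finset (Fin (d + 1)) // T ≠ Finset.univ} :=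
    fun i => ⟨{i}ᶜ, by simp [Finset.compl_eq_univ_iff]⟩
  let cell : Fin (d + 1) → Set.Ici v := fun i => φ.symm (S i)
  have hdim : ∀ i, L.dim (cell i).1 = d := fun i => by
    rw [hφ, OrderIso.apply_symm_apply, Finset.card_compl]
    simp
  have hinj : Function.Injective fun i => L.color (cell i).1 := by
    intro i j hij
    by_contra hne
    refine L.color_ne (cell i) (cell j) (hdim i) (hdim j) ?_ ?_ hij
    · intro h
      have h' : S i = S j := φ.symm.injective (Subtype.ext h)
      have h'' : ({i}ᶜ : Finset (Fin (d + 1))) = {j}ᶜ := congrArg Subtype.val h'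
      exact hne (by simpa using h'')
    · let T : {T : Finset (Fin (d + 1)) // T ≠ Finset.univ} :=
        ⟨{i, j}ᶜ, by rw [Ne, Finset.compl_eq_univ_iff]; exact Finset.insert_ne_empty _ _⟩
      refine ⟨(φ.symm T).1, ?_, ?_, ?_⟩
      · rw [hφ, OrderIso.apply_symm_apply, Finset.card_compl, Finset.card_pair hne,
          Fintype.card_fin]
        omega
      · exact φ.symm.monotone (show T ≤ S i from Finset.compl_subset_compl.2 (by simp))
      · exact φ.symm.monotone (show T ≤ S j from Finset.compl_subset_compl.2 (by simp))
  let ε : Equiv.Perm (Fin (d + 1)) :=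
    Equiv.ofBijective _ (Finite.injective_iff_bijective.1 hinj)
  have hε : ∀ i, ε i = L.color (cell i).1 := fun _ => rfl
  refine ⟨φ, ε, fun x => ⟨hφ x, fun j => ⟨?_, fun hj => ?_⟩⟩⟩
  · rintro ⟨⟨c, hc, hcol⟩, hxc⟩ hj
    let c' : Set.Ici v := ⟨c, le_trans x.2 hxc⟩
    have hcard : (φ c').1ᶜ.card = 1 := by
      rw [Finset.card_compl, ← hφ, Fintype.card_fin]
      change d + 1 - L.dim c = 1
      omega
    obtain ⟨i, hi⟩ := Finset.card_eq_one.1 hcard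
    have hcell : c' = cell i := by
      rw [← φ.symm_apply_apply c']
      congr 1
      apply Subtype.ext
      change (φ c').1 = {i}ᶜ
      rw [← hi, compl_compl]
    have hij : i = j := by
      apply ε.injective
      rw [hε, ← hcell]
      exact hcol
    have hle : (φ x).1 ⊆ (φ c').1 := φ.monotone (show x ≤ c' from hxc)
    have hmem := hle hj
    rw [← Finset.notMem_compl, hi, hij] at hmem
    simp at hmem
  · refine ⟨⟨cell j, hdim j, rfl⟩, ?_⟩
    have : x ≤ cell j := by
      rw [OrderIso.le_symm_apply]
      change (φ x).1 ⊆ {j}ᶜ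
      intro i hi
      rw [Finset.mem_compl, Finset.mem_singleton]
      rintro rfl
      exact hj hi
    exact this

theorem colorsOf_anti {x y : Cell} (h : x ≤ y) : L.colorsOf y ⊆ L.colorsOf x :=
  fun _ ⟨c, hc⟩ => ⟨c, h.trans hc⟩

theorem le_of_colorsOf_subset (hd : 2 ≤ d) {v x y : Cell} (hv : L.dim v = 0) (hx : v ≤ x)
    (hy : v ≤ y) (h : L.colorsOf y ⊆ L.colorsOf x) : x ≤ y := by
  obtain ⟨φ, ε, hφ⟩ := L.exists_chart hd hv
  have : φ ⟨x, hx⟩ ≤ φ ⟨y, hy⟩ := by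
    intro j hj
    by_contra hj'
    exact ((hφ ⟨x, hx⟩).2 j).1 (h (((hφ ⟨y, hy⟩).2 j).2 hj')) hj
  exact φ.le_iff_le.1 this

theorem eq_of_colorsOf_eq (hd : 2 ≤ d) {v x y : Cell} (hv : L.dim v = 0) (hx : v ≤ x)
    (hy : v ≤ y) (h : L.colorsOf x = L.colorsOf y) : x = y :=
  le_antisymm (L.le_of_colorsOf_subset hd hv hx hy h.ge)
    (L.le_of_colorsOf_subset hd hv hy hx h.le)

theorem exists_colorsOf_eq (hd : 2 ≤ d) {v : Cell} (hv : L.dim v = 0) {S : Set (Fin (d + 1))}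
    (hS : S.Nonempty) : ∃ x, v ≤ x ∧ L.colorsOf x = S := by
  classical
  obtain ⟨φ, ε, hφ⟩ := L.exists_chart hd hv
  obtain ⟨s, hs⟩ := hS
  let T : {T : Finset (Fin (d + 1)) // T ≠ Finset.univ} :=
    ⟨Finset.univ.filter fun j => ε j ∉ S, fun h => by
      have := Finset.mem_univ (ε.symm s)
      rw [← h] at this
      simp [hs] at this⟩
  refine ⟨φ.symm T, (φ.symm T).2, ?_⟩
  ext i
  obtain ⟨j, rfl⟩ := ε.surjective i
  rw [(hφ _).2, OrderIso.apply_symm_apply]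
  simp [T]

theorem dim_add_ncard_colorsOf (hd : 2 ≤ d) (x : Cell) :
    L.dim x + (L.colorsOf x).ncard = d + 1 := by
  obtain ⟨v, hvx, hv⟩ := L.exists_vertex x
  obtain ⟨φ, ε, hφ⟩ := L.exists_chart hd hv
  have h : L.colorsOf x = ε '' ((φ ⟨x, hvx⟩).1ᶜ : Finset (Fin (d + 1))) := by
    ext i
    obtain ⟨j, rfl⟩ := ε.surjective i
    rw [(hφ ⟨x, hvx⟩).2, ε.injective.mem_set_image]
    simp
  rw [h, Set.ncard_image_of_injective _ ε.injective, Set.ncard_coe_finset, Finset.card_compl,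
    Fintype.card_fin, show L.dim x = _ from (hφ ⟨x, hvx⟩).1]
  have := Finset.card_le_univ (φ ⟨x, hvx⟩).1
  rw [Fintype.card_fin] at this
  omega

theorem ncard_compl_colorsOf (hd : 2 ≤ d) (x : Cell) : ((L.colorsOf x)ᶜ).ncard = L.dim x := by
  have h := L.dim_add_ncard_colorsOf hd x
  have h' := Set.ncard_add_ncard_compl (L.colorsOf x)
  rw [Nat.card_eq_fintype_card, Fintype.card_fin] at h'
  omega

theorem colorsOf_of_dim_eq (hd : 2 ≤ d) {i : Fin (d + 1)} (c : L.CellOfColor i) :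
    L.colorsOf c.1 = {i} := by
  have h := L.dim_add_ncard_colorsOf hd c.1
  rw [c.2.1, add_right_inj] at h
  obtain ⟨j, hj⟩ := Set.ncard_eq_one.1 h
  have hi : i ∈ L.colorsOf c.1 := ⟨c, le_rfl⟩
  rw [hj] at hi ⊢
  rw [Set.mem_singleton_iff.1 hi]

theorem exists_colorsOf_edge (hd : 2 ≤ d) {e : Cell} (he : L.dim e = 1) :
    ∃ i, L.colorsOf e = {i}ᶜ := by
  obtain ⟨i, hi⟩ := Set.ncard_eq_one.1 ((L.ncard_compl_colorsOf hd e).trans he)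
  exact ⟨i, by rw [← hi, compl_compl]⟩

theorem exists_colorsOf_face (hd : 2 ≤ d) {f : Cell} (hf : L.dim f = 2) :
    ∃ i j, i ≠ j ∧ L.colorsOf f = {i, j}ᶜ := by
  obtain ⟨i, j, hij, h⟩ := Set.ncard_eq_two.1 ((L.ncard_compl_colorsOf hd f).trans hf)
  exact ⟨i, j, hij, by rw [← h, compl_compl]⟩

theorem dim_eq_of_colorsOf (hd : 2 ≤ d) {x : Cell} {S : Set (Fin (d + 1))}
    (h : L.colorsOf x = Sᶜ) : L.dim x = S.ncard := by
  rw [← L.ncard_compl_colorsOf hd, h, compl_compl]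

theorem colorsOf_vertex (hd : 2 ≤ d) {v : Cell} (hv : L.dim v = 0) : L.colorsOf v = Set.univ := by
  have h := L.ncard_compl_colorsOf hd v
  rw [hv, Set.ncard_eq_zero] at h
  exact Set.compl_empty_iff.1 h

theorem existsUnique_cellOfColor (hd : 2 ≤ d) {x : Cell} {i : Fin (d + 1)}
    (hi : i ∈ L.colorsOf x) : ∃! c : L.CellOfColor i, x ≤ c.1 := by
  obtain ⟨c, hc⟩ := hi
  refine ⟨c, hc, fun c' hc' => Subtype.ext ?_⟩
  obtain ⟨v, hvx, hv⟩ := L.exists_vertex x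
  exact L.eq_of_colorsOf_eq hd hv (hvx.trans hc') (hvx.trans hc)
    ((L.colorsOf_of_dim_eq hd c').trans (L.colorsOf_of_dim_eq hd c).symm)

/-- At a vertex there is only one `d`-cell of each color, so a cell having color `i` and meeting `c`
there must lie in `c`. -/
theorem le_of_vertex_le (hd : 2 ≤ d) {v x : Cell} (hv : L.dim v = 0) (hvx : v ≤ x)
    {i : Fin (d + 1)} (hi : i ∈ L.colorsOf x) {c : L.CellOfColor i} (hc : v ≤ c.1) : x ≤ c.1 :=
  L.le_of_colorsOf_subset hd hv hvx hc (by
    rw [L.colorsOf_of_dim_eq hd c]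
    exact Set.singleton_subset_iff.2 hi)

end ColoredLattice

/-! ### The graph of edges in the `d`-cells of color `C_0` -/

namespace ColoredLattice

variable {Cell : Type*} [PartialOrder Cell] {d : ℕ} (L : ColoredLattice Cell d)

/-- The edge carrying a toric code qubit. -/
def edgeCell (q : L.TargetQubit) : Cell := q.2.1.1

theorem dim_edgeCell (q : L.TargetQubit) : L.dim (L.edgeCell q) = 1 := q.2.1.2

theorem colorsOf_edgeCell (q : L.TargetQubit) : L.colorsOf (L.edgeCell q) = {q.1.succ}ᶜ := q.2.2

/-- The shrunk lattice to which a qubit belongs is recovered from the color that its edge misses. -/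
theorem edgeCell_injective : Function.Injective L.edgeCell := by
  rintro ⟨j, ⟨e, he⟩, h⟩ ⟨j', ⟨e', he'⟩, h'⟩ (heq : e = e')
  subst heq
  have hj : j = j' := by
    have : ({j.succ}ᶜ : Set (Fin (d + 1))) = {j'.succ}ᶜ := h.symm.trans h'
    simpa using this
  subst hj
  rfl

theorem zero_mem_colorsOf_edgeCell (q : L.TargetQubit) : 0 ∈ L.colorsOf (L.edgeCell q) := by
  rw [colorsOf_edgeCell]
  exact fun h => Fin.succ_ne_zero q.1 (Set.mem_singleton_iff.1 h).symm

theorem exists_edgeCell_eq (hd : 2 ≤ d) {e : Cell} (he : L.dim e = 1) (h0 : 0 ∈ L.colorsOf e) :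
    ∃ q, L.edgeCell q = e := by
  obtain ⟨i, hi⟩ := L.exists_colorsOf_edge hd he
  have hi0 : i ≠ 0 := by
    rintro rfl
    rw [hi] at h0
    exact h0 rfl
  obtain ⟨j, rfl⟩ := Fin.exists_succ_eq.2 hi0
  exact ⟨⟨j, ⟨e, he⟩, hi⟩, rfl⟩

theorem zero_mem_colorsOf_vertex (hd : 2 ≤ d) (v : L.CellOfDim 0) : 0 ∈ L.colorsOf v.1 := by
  rw [L.colorsOf_vertex hd v.2]
  trivial

/-- The `d`-cell of color `C_0` at a vertex. -/
def vertexRegion (hd : 2 ≤ d) (v : L.CellOfDim 0) : L.CellOfColor 0 :=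
  (L.existsUnique_cellOfColor hd (L.zero_mem_colorsOf_vertex hd v)).choose

/-- The `d`-cell of color `C_0` containing an edge. -/
def edgeRegion (hd : 2 ≤ d) (q : L.TargetQubit) : L.CellOfColor 0 :=
  (L.existsUnique_cellOfColor hd (L.zero_mem_colorsOf_edgeCell q)).choose

theorem vertexRegion_eq_iff (hd : 2 ≤ d) {v : L.CellOfDim 0} {c : L.CellOfColor 0} :
    L.vertexRegion hd v = c ↔ v.1 ≤ c.1 := by
  have h := (L.existsUnique_cellOfColor hd (L.zero_mem_colorsOf_vertex hd v)).choose_spec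
  exact ⟨fun hc => hc ▸ h.1, fun hc => (h.2 c hc).symm⟩

theorem edgeRegion_eq_iff (hd : 2 ≤ d) {q : L.TargetQubit} {c : L.CellOfColor 0} :
    L.edgeRegion hd q = c ↔ L.edgeCell q ≤ c.1 := by
  have h := (L.existsUnique_cellOfColor hd (L.zero_mem_colorsOf_edgeCell q)).choose_spec
  exact ⟨fun hc => hc ▸ h.1, fun hc => (h.2 c hc).symm⟩

theorem mem_sourceRegion_iff (hd : 2 ≤ d) (c : L.CellOfColor 0) (q : L.SourceQubit) :
    q ∈ L.sourceRegion c ↔ Sum.elim (L.vertexRegion hd) (fun a : L.Ancilla => a.1) q = c := by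
  cases q with
  | inl v => simp [sourceRegion, verticesOf, vertexRegion_eq_iff]
  | inr a => simp [sourceRegion]

theorem mem_targetRegion_iff (hd : 2 ≤ d) (c : L.CellOfColor 0) (q : L.TargetQubit) :
    q ∈ L.targetRegion c ↔ L.edgeRegion hd q = c :=
  (L.edgeRegion_eq_iff hd).symm

theorem existsUnique_edge (hd : 2 ≤ d) (v : L.CellOfDim 0) (j : Fin d) :
    ∃! q : L.TargetQubit, q.1 = j ∧ v.1 ≤ L.edgeCell q := by
  have hne : ({j.succ}ᶜ : Set (Fin (d + 1))).Nonempty := ⟨0, (Fin.succ_ne_zero j).symm⟩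
  obtain ⟨e, hve, he⟩ := L.exists_colorsOf_eq hd v.2 hne
  have hdim : L.dim e = 1 := by rw [L.dim_eq_of_colorsOf hd he, Set.ncard_singleton]
  refine ⟨⟨j, ⟨e, hdim⟩, he⟩, ⟨rfl, hve⟩, ?_⟩
  rintro q ⟨rfl, hq⟩
  apply L.edgeCell_injective
  exact L.eq_of_colorsOf_eq hd v.2 hq hve ((L.colorsOf_edgeCell q).trans he.symm)

theorem ncard_verticesOf_edge {e : Cell} (he : L.dim e = 1) : (L.verticesOf e).ncard = 2 := by
  rw [← L.edge_ends e he, ← Set.ncard_image_of_injective _ Subtype.val_injective]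
  congr 1
  ext v
  simp [verticesOf, and_comm]

open Classical in
/-- The vertices of a cell, as a binary vector. -/
def vertexVec (x : Cell) : L.CellOfDim 0 → ZMod 2 := fun v => if v.1 ≤ x then 1 else 0

open Classical in
/-- The incidence matrix of vertices and edges. -/
def incidence : Matrix (L.CellOfDim 0) L.TargetQubit (ZMod 2) :=
  fun v q => if v.1 ≤ L.edgeCell q then 1 else 0

open Classical in
/-- The edges of a cell that belong to the shrunk lattice `L_{j+1}`, as a binary vector. -/
def shrunkVec (j : Fin d) (x : Cell) : L.TargetQubit → ZMod 2 :=
  fun q => if q.1 = j ∧ L.edgeCell q ≤ x then 1 else 0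

theorem vertexRegion_eq_edgeRegion (hd : 2 ≤ d) {v : L.CellOfDim 0} {q : L.TargetQubit}
    (h : v.1 ≤ L.edgeCell q) : L.vertexRegion hd v = L.edgeRegion hd q :=
  (L.vertexRegion_eq_iff hd).2 (h.trans ((L.edgeRegion_eq_iff hd).1 rfl))

/-- Double counting: as `d ≥ 2`, each vertex has at least two edges in the cell, and an edge has
only two ends. This keeps the truncated subtraction in the number of ancillas honest. -/
theorem ncard_verticesOf_le_ncard_edgesOf [Finite Cell] (hd : 2 ≤ d) (c : L.CellOfColor 0) :
    (L.verticesOf c.1).ncard ≤ Nat.card {q // L.edgeRegion hd q = c} := by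
  classical
  have := Fintype.ofFinite Cell
  rw [Set.ncard_eq_toFinset_card', Nat.card_eq_fintype_card, Fintype.card_subtype]
  have h := Finset.card_mul_le_card_mul (m := 2) (n := 2)
    (s := (L.verticesOf c.1).toFinset) (t := Finset.univ.filter fun q => L.edgeRegion hd q = c)
    (fun v q => v.1 ≤ L.edgeCell q) ?_ ?_
  · omega
  · intro v hv
    rw [Set.mem_toFinset] at hv
    obtain ⟨q, ⟨hq, hvq⟩, -⟩ := L.existsUnique_edge hd v ⟨0, by omega⟩
    obtain ⟨q', ⟨hq', hvq'⟩, -⟩ := L.existsUnique_edge hd v ⟨1, by omega⟩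
    have hne : q ≠ q' := by
      rintro rfl
      simp [hq] at hq'
    rw [← Finset.card_pair hne]
    refine Finset.card_le_card ?_
    have hc := (L.vertexRegion_eq_iff hd).2 hv
    intro p hp
    rw [Finset.mem_insert, Finset.mem_singleton] at hp
    rw [Finset.mem_bipartiteAbove, Finset.mem_filter]
    rcases hp with rfl | rfl
    · exact ⟨⟨Finset.mem_univ _, (L.vertexRegion_eq_edgeRegion hd hvq).symm.trans hc⟩, hvq⟩
    · exact ⟨⟨Finset.mem_univ _, (L.vertexRegion_eq_edgeRegion hd hvq').symm.trans hc⟩, hvq'⟩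
  · intro q _
    rw [← L.ncard_verticesOf_edge (L.dim_edgeCell q), Set.ncard_eq_toFinset_card']
    refine Finset.card_le_card fun v hv => ?_
    rw [Set.mem_toFinset]
    exact ((Finset.mem_bipartiteBelow _).1 hv).2

theorem ncard_edgesOf [Finite Cell] (hd : 2 ≤ d) (c : L.CellOfColor 0) :
    (L.edgesOf c.1).ncard = Nat.card {q // L.edgeRegion hd q = c} := by
  rw [← Nat.card_coe_set_eq]
  refine (Nat.card_congr (Equiv.ofBijective
    (fun q => ⟨q.1.2.1, (L.edgeRegion_eq_iff hd).1 q.2⟩ :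
      {q // L.edgeRegion hd q = c} → L.edgesOf c.1) ⟨?_, ?_⟩)).symm
  · intro q q' h
    apply Subtype.ext
    apply L.edgeCell_injective
    exact congrArg (fun e => e.1.1) h
  · rintro ⟨⟨e, he⟩, hec⟩
    have h0 : 0 ∈ L.colorsOf e := ⟨c, hec⟩
    obtain ⟨q, rfl⟩ := L.exists_edgeCell_eq hd he h0
    exact ⟨⟨q, (L.edgeRegion_eq_iff hd).2 hec⟩, rfl⟩

theorem card_edges_eq [Finite Cell] (hd : 2 ≤ d) (c : L.CellOfColor 0) :
    Nat.card {q // L.edgeRegion hd q = c} =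
      Nat.card {v // L.vertexRegion hd v = c} + Nat.card {a : L.Ancilla // a.1 = c} := by
  have h1 := L.ncard_verticesOf_le_ncard_edgesOf hd c
  have h2 : Nat.card {v // L.vertexRegion hd v = c} = (L.verticesOf c.1).ncard := by
    rw [← Nat.card_coe_set_eq]
    exact Nat.card_congr (Equiv.subtypeEquivRight fun v => L.vertexRegion_eq_iff hd)
  have h3 : Nat.card {a : L.Ancilla // a.1 = c} =
      (L.edgesOf c.1).ncard - (L.verticesOf c.1).ncard := by
    rw [Nat.card_congr (Equiv.sigmaSubtype c), Nat.card_eq_fintype_card, Fintype.card_fin]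
  rw [h2, h3, L.ncard_edgesOf hd c]
  omega

open Classical in
theorem sum_incidence [Fintype Cell] (q : L.TargetQubit) : ∑ v, L.incidence v q = 0 := by
  have h := L.ncard_verticesOf_edge (L.dim_edgeCell q)
  simp only [incidence]
  rw [Finset.sum_boole, ← Set.ncard_coe_finset]
  have : ((Finset.univ.filter fun v : L.CellOfDim 0 => v.1 ≤ L.edgeCell q : Finset _) :
      Set (L.CellOfDim 0)) = L.verticesOf (L.edgeCell q) := by
    ext v; simp [verticesOf]
  rw [this, h]
  rfl

open Classical in
theorem cellBoundary_vertex [Fintype Cell] (hd : 2 ≤ d) {w : Cell → ZMod 2}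
    (hw : ∀ x, w x ≠ 0 → L.dim x = 1 ∧ 0 ∈ L.colorsOf x) (v : L.CellOfDim 0) :
    cellBoundary L.dim w v.1 = (L.incidence *ᵥ fun q => w (L.edgeCell q)) v := by
  simp only [cellBoundary, finsum_eq_if, finsum_eq_sum_of_fintype, Matrix.mulVec, dotProduct,
    incidence, ite_mul, one_mul, zero_mul]
  refine (Fintype.sum_of_injective L.edgeCell L.edgeCell_injective _ _ ?_ ?_).symm
  · intro x hx
    by_cases h : w x = 0
    · simp [h]
    · exact absurd (L.exists_edgeCell_eq hd (hw x h).1 (hw x h).2) hx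
  · intro q
    simp [v.2, L.dim_edgeCell q]

-- Connectedness of the cell: an even set of its vertices bounds, by vanishing reduced `H₀`, and the
-- bounding edges have color `C_0`.
open Classical in
theorem exists_incidence_mulVec_eq [Fintype Cell] (hd : 2 ≤ d) (c : L.CellOfColor 0)
    (s : L.CellOfDim 0 → ZMod 2) (hs : ∀ v, s v ≠ 0 → L.vertexRegion hd v = c)
    (hsum : ∑ v, s v = 0) : ∃ t, L.incidence *ᵥ t = s := by
  let z : Cell → ZMod 2 := fun x => if h : L.dim x = 0 then s ⟨x, h⟩ else 0
  have hz : ∀ v : L.CellOfDim 0, z v.1 = s v := fun v => dif_pos v.2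
  have hchain : IsChainIn L.dim c.1 0 z := by
    intro x hx
    by_cases h : L.dim x = 0
    · refine ⟨?_, h⟩
      rw [show z x = s ⟨x, h⟩ from dif_pos h] at hx
      exact (L.vertexRegion_eq_iff hd).1 (hs _ hx)
    · exact absurd (dif_neg h) hx
  have hzsum : ∑ᶠ x, z x = 0 := by
    rw [finsum_eq_sum_of_fintype, ← hsum]
    refine (Fintype.sum_of_injective (fun v : L.CellOfDim 0 => v.1) Subtype.val_injective _ _
      ?_ fun v => (hz v).symm).symm
    intro x hx
    exact dif_neg fun h => hx ⟨⟨x, h⟩, rfl⟩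
  obtain ⟨w, hw, hwz⟩ := (L.ball c.1).1 z hchain hzsum
  refine ⟨fun q => w (L.edgeCell q), ?_⟩
  funext v
  rw [← L.cellBoundary_vertex hd (fun x hx => ⟨(hw x hx).2, c, (hw x hx).1⟩), hwz, hz]

-- Through each vertex of `f` passes exactly one edge missing the color `j.succ`, and it lies in `f`
-- because it has all colors of `f`.
open Classical in
theorem incidence_mulVec_shrunkVec [Fintype Cell] (hd : 2 ≤ d) {f : Cell} {i : Fin (d + 1)}
    {j : Fin d} (hf : L.colorsOf f = {j.succ, i}ᶜ) :
    L.incidence *ᵥ L.shrunkVec j f = L.vertexVec f := by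
  funext v
  simp only [Matrix.mulVec, dotProduct, incidence, shrunkVec, vertexVec, mul_ite, mul_one,
    mul_zero]
  by_cases hv : v.1 ≤ f
  · obtain ⟨q, ⟨hq, hvq⟩, huniq⟩ := L.existsUnique_edge hd v j
    have hqf : L.edgeCell q ≤ f := L.le_of_colorsOf_subset hd v.2 hvq hv (by
      rw [hf, L.colorsOf_edgeCell, hq]
      exact Set.compl_subset_compl.2 (by simp))
    rw [if_pos hv, Finset.sum_eq_single q]
    · simp [hq, hqf, hvq]
    · intro p _ hp
      split_ifs with h1 h2
      · exact absurd (huniq p ⟨h1.1, h2⟩) hp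
      · rfl
      · rfl
    · simp
  · rw [if_neg hv]
    refine Finset.sum_eq_zero fun q _ => ?_
    split_ifs with h1 h2
    · exact absurd (h2.trans h1.2) hv
    · rfl
    · rfl

open Classical in
theorem vertexVec_vecMul_incidence [Fintype Cell] (x : Cell) (q : L.TargetQubit) :
    (L.vertexVec x ᵥ* L.incidence) q =
      ((L.verticesOf (L.edgeCell q) ∩ L.verticesOf x).ncard : ZMod 2) := by
  simp only [Matrix.vecMul, dotProduct, incidence, vertexVec, mul_ite, mul_one, mul_zero]
  rw [← Finset.sum_filter, Finset.sum_boole, ← Set.ncard_coe_finset]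
  congr 2
  ext v
  simp [verticesOf]

-- An edge that has color `i` and meets `c` lies in `c`, so it has 0 or 2 ends there.
open Classical in
theorem vertexVec_vecMul_incidence_of_ne [Fintype Cell] (hd : 2 ≤ d) {i : Fin (d + 1)}
    (c : L.CellOfColor i) (q : L.TargetQubit) (hq : q.1.succ ≠ i) :
    (L.vertexVec c.1 ᵥ* L.incidence) q = 0 := by
  rw [vertexVec_vecMul_incidence]
  rcases Set.eq_empty_or_nonempty (L.verticesOf (L.edgeCell q) ∩ L.verticesOf c.1) with h | h
  · rw [h, Set.ncard_empty, Nat.cast_zero]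
  · obtain ⟨v, hvq, hvc⟩ := h
    have hle : L.edgeCell q ≤ c.1 := L.le_of_vertex_le hd v.2 hvq (by
      rw [colorsOf_edgeCell]
      exact fun h => hq (Set.mem_singleton_iff.1 h).symm) hvc
    have hsub : L.verticesOf (L.edgeCell q) ⊆ L.verticesOf c.1 := fun u hu =>
      le_trans (show u.1 ≤ L.edgeCell q from hu) hle
    rw [Set.inter_eq_left.2 hsub, L.ncard_verticesOf_edge (L.dim_edgeCell q)]
    rfl

open Classical in
/-- Since the closed `d`-cells have no first homology, the cycles are generated by the parts of
2-cells that belong to one of the shrunk lattices. -/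
theorem mem_of_incidence_mulVec_eq_zero [Fintype Cell] (hd : 2 ≤ d)
    (S : AddSubmonoid (L.TargetQubit → ZMod 2))
    (hS : ∀ f i (j : Fin d), i ≠ j.succ → L.colorsOf f = {j.succ, i}ᶜ → L.shrunkVec j f ∈ S)
    (k : L.TargetQubit → ZMod 2) (hk : L.incidence *ᵥ k = 0) : k ∈ S := by
  -- Every edge of the graph lies in just one cell of color `C_0`, as do all edges of the graph at a
  -- given vertex; so the cycle splits into cycles of single cells.
  let kc : L.CellOfColor 0 → L.TargetQubit → ZMod 2 :=
    fun c q => if L.edgeRegion hd q = c then k q else 0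
  have hsum : k = ∑ c, kc c := by
    funext q
    simp [kc, Finset.sum_apply]
  rw [hsum]
  refine S.sum_mem fun c _ => ?_
  let z : Cell → ZMod 2 := fun x => if h : ∃ q, L.edgeCell q = x then kc c h.choose else 0
  have hz : ∀ q, z (L.edgeCell q) = kc c q := by
    intro q
    have h : ∃ p, L.edgeCell p = L.edgeCell q := ⟨q, rfl⟩
    rw [show z (L.edgeCell q) = kc c h.choose from dif_pos h,
      L.edgeCell_injective h.choose_spec]
  have hz' : ∀ x, z x ≠ 0 → ∃ q, L.edgeCell q = x ∧ L.edgeRegion hd q = c := by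
    intro x hx
    have h : ∃ q, L.edgeCell q = x := by
      by_contra h
      exact hx (dif_neg h)
    obtain ⟨q, rfl⟩ := h
    refine ⟨q, rfl, ?_⟩
    by_contra h
    exact hx ((hz q).trans (if_neg h))
  have hcyc : L.incidence *ᵥ kc c = 0 := by
    funext v
    by_cases hv : L.vertexRegion hd v = c
    · rw [← hk]
      simp only [Matrix.mulVec, dotProduct, incidence, ite_mul, one_mul, zero_mul]
      refine Finset.sum_congr rfl fun q _ => ?_
      split_ifs with h
      · exact if_pos ((L.vertexRegion_eq_edgeRegion hd h).symm.trans hv)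
      · rfl
    · simp only [Matrix.mulVec, dotProduct, incidence, ite_mul, one_mul, zero_mul]
      refine Finset.sum_eq_zero fun q _ => ?_
      split_ifs with h
      · exact if_neg fun hq => hv ((L.vertexRegion_eq_edgeRegion hd h).trans hq)
      · rfl
  have hchain : IsChainIn L.dim c.1 1 z := by
    intro x hx
    obtain ⟨q, rfl, hq⟩ := hz' x hx
    exact ⟨(L.edgeRegion_eq_iff hd).1 hq, L.dim_edgeCell q⟩
  have hbdry : cellBoundary L.dim z = 0 := by
    funext x
    by_cases hx : L.dim x = 0
    · have h := L.cellBoundary_vertex hd (w := z) (fun y hy => by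
        obtain ⟨q, rfl, -⟩ := hz' y hy
        exact ⟨L.dim_edgeCell q, L.zero_mem_colorsOf_edgeCell q⟩) ⟨x, hx⟩
      rw [h]
      simp only [hz]
      exact congrFun hcyc _
    · simp only [cellBoundary, finsum_eq_if, finsum_eq_sum_of_fintype]
      refine Finset.sum_eq_zero fun y _ => ?_
      split_ifs with h
      · by_contra hy
        obtain ⟨q, rfl, -⟩ := hz' y hy
        rw [L.dim_edgeCell] at h
        omega
      · rfl
  obtain ⟨w, hw, hwz⟩ := (L.ball c.1).2 0 z hchain hbdry
  have hkc : kc c = ∑ f, if w f = 0 then 0 else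
      fun q => if L.edgeCell q ≤ f then (1 : ZMod 2) else 0 := by
    funext q
    rw [← hz, ← hwz, Finset.sum_apply]
    simp only [cellBoundary, finsum_eq_if, finsum_eq_sum_of_fintype]
    refine Finset.sum_congr rfl fun f _ => ?_
    have h01 : ∀ s : ZMod 2, s ≠ 0 → s = 1 := by decide
    by_cases hf : w f = 0
    · simp [hf]
    · have hdim := (hw f hf).2
      simp [h01 _ hf, hdim, L.dim_edgeCell q]
  rw [hkc]
  refine S.sum_mem fun f _ => ?_
  split_ifs with hf
  · exact S.zero_mem
  · obtain ⟨hfc, hdim⟩ := hw f hf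
    obtain ⟨i, j, hij, hcol⟩ := L.exists_colorsOf_face hd hdim
    have h0 : (0 : Fin (d + 1)) ∈ L.colorsOf f := ⟨c, hfc⟩
    -- Since `f` lies in a cell of color `C_0`, both colors it misses are different from `C_0`, and
    -- each of its edges misses exactly one of the two.
    rw [hcol, Set.mem_compl_iff, Set.mem_insert_iff, Set.mem_singleton_iff, not_or] at h0
    obtain ⟨i, rfl⟩ := Fin.exists_succ_eq.2 (Ne.symm h0.1)
    obtain ⟨j, rfl⟩ := Fin.exists_succ_eq.2 (Ne.symm h0.2)
    have hsplit : (fun q => if L.edgeCell q ≤ f then (1 : ZMod 2) else 0) =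
        L.shrunkVec i f + L.shrunkVec j f := by
      funext q
      simp only [Pi.add_apply, shrunkVec]
      by_cases hq : L.edgeCell q ≤ f
      · have hmem := L.colorsOf_anti hq
        rw [hcol, L.colorsOf_edgeCell, Set.compl_subset_compl, Set.singleton_subset_iff,
          Set.mem_insert_iff, Set.mem_singleton_iff, Fin.succ_inj, Fin.succ_inj] at hmem
        have hne : i ≠ j := fun h => hij (congrArg _ h)
        rcases hmem with h | h
        · simp [hq, h, hne]
        · simp [hq, h, hne.symm]
      · simp [hq]
    rw [hsplit]
    refine S.add_mem (hS f j.succ i hij.symm hcol) (hS f i.succ j hij ?_)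
    rw [hcol, Set.pair_comm]

end ColoredLattice

/-! ### The stabilizer groups -/

namespace ColoredLattice

variable {Cell : Type*} [PartialOrder Cell] {d : ℕ} (L : ColoredLattice Cell d)

/-- The color code with its ancillas, as a group of invertible operators. -/
def sourceGroup [Finite Cell] : Subgroup (Op L.SourceQubit)ˣ :=
  (L.colorCode.prod L.ancillaGroup).map (sumTensorHom (L.CellOfDim 0) L.Ancilla)

/-- The product of the toric codes, as a group of invertible operators. -/
def targetGroup [Finite Cell] : Subgroup (Op L.TargetQubit)ˣ :=
  (Subgroup.pi Set.univ fun j : Fin d => (L.shrunk j.succ).toricCode).map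
    (sigmaTensorHom fun j : Fin d => L.ShrunkEdge j.succ)

theorem pauliXOn_verticesOf [Finite Cell] (x : Cell) :
    pauliXOn (L.verticesOf x) = xOp (L.vertexVec x) := by
  classical
  rw [pauliXOn, pauliX_eq_xOp, natCast_indicator]
  congr

theorem pauliZOn_verticesOf [Finite Cell] (x : Cell) :
    pauliZOn (L.verticesOf x) = zOp (L.vertexVec x) := by
  classical
  rw [pauliZOn, pauliZ_eq_zOp, natCast_indicator]
  congr

theorem sigmaTensorHom_sides [Finite Cell] (j : Fin d) (f : L.ShrunkFace j.succ) :
    sigmaTensorHom (fun j : Fin d => L.ShrunkEdge j.succ)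
      (Pi.mulSingle j (pauliZ ((L.shrunk j.succ).sides f))) = zOp (L.shrunkVec j f.1.1) := by
  classical
  rw [← sigmaTensorHom_zOp j (L.shrunkVec j f.1.1) fun q hq => if_neg fun h => hq h.1,
    pauliZ_eq_zOp]
  congr 3
  funext e
  simp [shrunk, Set.indicator_apply, shrunkVec, edgeCell]

/-- On the registers of the other shrunk lattices the vector vanishes mod 2, so one matrix product
describes the generator on the whole target register. -/
theorem sigmaTensorHom_ends [Fintype Cell] [Fintype (L.CellOfDim 0)] (hd : 2 ≤ d) (j : Fin d)
    (c : L.ShrunkVertex j.succ) :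
    sigmaTensorHom (fun j : Fin d => L.ShrunkEdge j.succ)
      (Pi.mulSingle j (pauliX ((L.shrunk j.succ).ends c))) =
      xOp (L.vertexVec c.1 ᵥ* L.incidence) := by
  classical
  rw [← sigmaTensorHom_xOp j _ fun q hq => ?_, pauliX_eq_xOp]
  · congr 3
    funext e
    convert (L.vertexVec_vecMul_incidence c.1 ⟨j, e⟩).symm
    rfl
  · convert L.vertexVec_vecMul_incidence_of_ne hd c q fun h => hq (Fin.succ_inj.1 h)

section Generators

variable [Finite Cell]

theorem xOp_vertexVec_mem_sourceGroup (c : L.CellOfDim d) :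
    xOp (Sum.elim (L.vertexVec c.1) 0) ∈ L.sourceGroup := by
  refine ⟨(xOp (L.vertexVec c.1), xOp 0), ⟨?_, ?_⟩, sumTensorHom_xOp _ _⟩
  · exact Subgroup.subset_closure (Or.inl ⟨c, L.pauliXOn_verticesOf c.1⟩)
  · rw [xOp_zero]
    exact L.ancillaGroup.one_mem

theorem zOp_vertexVec_mem_sourceGroup (f : L.CellOfDim 2) :
    zOp (Sum.elim (L.vertexVec f.1) 0) ∈ L.sourceGroup := by
  refine ⟨(zOp (L.vertexVec f.1), zOp 0), ⟨?_, ?_⟩, sumTensorHom_zOp _ _⟩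
  · exact Subgroup.subset_closure (Or.inr ⟨f, L.pauliZOn_verticesOf f.1⟩)
  · rw [zOp_zero]
    exact L.ancillaGroup.one_mem

theorem zOp_ancilla_mem_sourceGroup (b : L.Ancilla → ZMod 2) :
    zOp (Sum.elim 0 b) ∈ L.sourceGroup := by
  classical
  refine ⟨(zOp 0, zOp b), ⟨?_, ?_⟩, sumTensorHom_zOp _ _⟩
  · rw [zOp_zero]
    exact L.colorCode.one_mem
  · refine mem_of_single_mem (zVectors L.ancillaGroup) (fun a => ?_) b
    exact Subgroup.subset_closure ⟨a, pauliZOn_singleton a⟩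

theorem sourceGroup_le {K : Subgroup (Op L.SourceQubit)ˣ}
    (hX : ∀ c : L.CellOfDim d, xOp (Sum.elim (L.vertexVec c.1) 0) ∈ K)
    (hZ : ∀ f : L.CellOfDim 2, zOp (Sum.elim (L.vertexVec f.1) 0) ∈ K)
    (hA : ∀ b, zOp (Sum.elim 0 b) ∈ K) : L.sourceGroup ≤ K := by
  classical
  rw [sourceGroup, Subgroup.map_le_iff_le_comap, Subgroup.prod_le_iff,
    Subgroup.map_le_iff_le_comap, Subgroup.map_le_iff_le_comap]
  constructor
  · refine (Subgroup.closure_le _).2 ?_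
    rintro _ (⟨c, rfl⟩ | ⟨f, rfl⟩)
    · change sumTensorHom _ _ (pauliXOn (L.verticesOf c.1), 1) ∈ K
      rw [pauliXOn_verticesOf, ← xOp_zero, sumTensorHom_xOp]
      exact hX c
    · change sumTensorHom _ _ (pauliZOn (L.verticesOf f.1), 1) ∈ K
      rw [pauliZOn_verticesOf, ← zOp_zero, sumTensorHom_zOp]
      exact hZ f
  · refine (Subgroup.closure_le _).2 ?_
    rintro _ ⟨a, rfl⟩
    change sumTensorHom _ _ (1, pauliZOn {a}) ∈ K
    rw [pauliZOn_singleton, ← zOp_zero, sumTensorHom_zOp]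
    exact hA _

theorem zOp_shrunkVec_mem_targetGroup (hd : 2 ≤ d) {f : Cell} {i : Fin (d + 1)} {j : Fin d}
    (hi : i ≠ j.succ) (hf : L.colorsOf f = {j.succ, i}ᶜ) :
    zOp (L.shrunkVec j f) ∈ L.targetGroup := by
  have hdim : L.dim f = 2 := by
    rw [L.dim_eq_of_colorsOf hd hf, Set.ncard_pair hi.symm]
  rw [← L.sigmaTensorHom_sides j ⟨⟨f, hdim⟩, i, hi, hf⟩]
  refine Subgroup.mem_map_of_mem _ ((Subgroup.mulSingle_mem_pi _ _).2 fun _ => ?_)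
  exact Subgroup.subset_closure (Or.inr ⟨_, rfl⟩)

end Generators

theorem xOp_ends_mem_targetGroup [Fintype Cell] [Fintype (L.CellOfDim 0)] (hd : 2 ≤ d)
    {i : Fin (d + 1)} (c : L.CellOfColor i) :
    xOp (L.vertexVec c.1 ᵥ* L.incidence) ∈ L.targetGroup := by
  classical
  induction i using Fin.cases with
  | zero =>
    have h : L.vertexVec c.1 ᵥ* L.incidence = 0 := by
      funext q
      rw [Pi.zero_apply]
      convert L.vertexVec_vecMul_incidence_of_ne hd c q (Fin.succ_ne_zero _)
    rw [h, xOp_zero]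
    exact L.targetGroup.one_mem
  | succ j =>
    rw [← L.sigmaTensorHom_ends hd j c]
    refine Subgroup.mem_map_of_mem _ ((Subgroup.mulSingle_mem_pi _ _).2 fun _ => ?_)
    exact Subgroup.subset_closure (Or.inl ⟨_, rfl⟩)

theorem targetGroup_le [Fintype Cell] [Fintype (L.CellOfDim 0)] (hd : 2 ≤ d)
    {K : Subgroup (Op L.TargetQubit)ˣ}
    (hX : ∀ c : L.CellOfDim d, xOp (L.vertexVec c.1 ᵥ* L.incidence) ∈ K)
    (hZ : ∀ f i (j : Fin d), i ≠ j.succ → L.colorsOf f = {j.succ, i}ᶜ →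
      zOp (L.shrunkVec j f) ∈ K) : L.targetGroup ≤ K := by
  rw [targetGroup, Subgroup.map_le_iff_le_comap, Subgroup.pi_le_iff]
  intro j
  rw [Subgroup.map_le_iff_le_comap]
  refine (Subgroup.closure_le _).2 ?_
  rintro _ (⟨c, rfl⟩ | ⟨f, rfl⟩)
  · change sigmaTensorHom _ (Pi.mulSingle j (pauliX ((L.shrunk j.succ).ends c))) ∈ K
    rw [L.sigmaTensorHom_ends hd]
    exact hX ⟨c.1, c.2.1⟩
  · change sigmaTensorHom _ (Pi.mulSingle j (pauliZ ((L.shrunk j.succ).sides f))) ∈ K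
    rw [L.sigmaTensorHom_sides]
    obtain ⟨f, i, hi, hf⟩ := f
    exact hZ f.1 i j hi hf

theorem exists_clifford_unfolding [Fintype Cell] [Fintype (L.CellOfDim 0)]
    [Fintype L.TargetQubit] (hd : 2 ≤ d) :
    ∃ U : ∀ c : L.CellOfColor 0, LinOp (L.targetRegion c) (L.sourceRegion c),
      (∀ c, IsClifford (U c)) ∧ IsClifford (regionTensor U) ∧
      (∀ w, ∃ k, L.incidence *ᵥ k = 0 ∧
        Carries (regionTensor U) (xOp (Sum.elim w 0)) (xOp (w ᵥ* L.incidence) * zOp k)) ∧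
      (∀ t b, ∃ k, L.incidence *ᵥ k = 0 ∧
        Carries (regionTensor U) (zOp (Sum.elim (L.incidence *ᵥ t) b)) (zOp (t + k))) ∧
      ∀ k, L.incidence *ᵥ k = 0 → ∃ (α : L.CellOfColor 0 → ZMod 2) (b : L.Ancilla → ZMod 2),
        Carries (regionTensor U)
          (xOp (Sum.elim (fun v => α (L.vertexRegion hd v)) 0) * zOp (Sum.elim 0 b)) (zOp k) := by
  classical
  have := Fintype.ofFinite L.Ancilla
  refine exists_clifford_of_components (rE := L.edgeRegion hd) ?_ (L.mem_sourceRegion_iff hd)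
    (L.mem_targetRegion_iff hd) ?_ ?_ ?_ (L.card_edges_eq hd)
  · intro v q h
    refine L.vertexRegion_eq_edgeRegion hd ?_
    by_contra h'
    exact h (if_neg h')
  · intro c
    obtain ⟨v, hvc, hv⟩ := L.exists_vertex c.1
    exact ⟨⟨v, hv⟩, (L.vertexRegion_eq_iff hd).2 hvc⟩
  · intro q
    convert L.sum_incidence q
  · intro c s hs hsum
    convert L.exists_incidence_mulVec_eq hd c s hs (by convert hsum)

/-- Both groups contain `Z` on every cycle, so the unspecified cycles `k` in `hX` and `hZ` can be
absorbed on either side. -/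
theorem map_conjHom_sourceGroup [Fintype Cell] [Fintype (L.CellOfDim 0)]
    [Fintype L.TargetQubit] (hd : 2 ≤ d) {U : LinOp L.TargetQubit L.SourceQubit}
    (h₁ : Uᴴ * U = 1) (h₂ : U * Uᴴ = 1)
    (hX : ∀ w, ∃ k, L.incidence *ᵥ k = 0 ∧
      Carries U (xOp (Sum.elim w 0)) (xOp (w ᵥ* L.incidence) * zOp k))
    (hZ : ∀ t b, ∃ k, L.incidence *ᵥ k = 0 ∧
      Carries U (zOp (Sum.elim (L.incidence *ᵥ t) b)) (zOp (t + k)))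
    (hK : ∀ k, L.incidence *ᵥ k = 0 →
      ∃ (α : L.CellOfColor 0 → ZMod 2) (b : L.Ancilla → ZMod 2), Carries U
        (xOp (Sum.elim (fun v => α (L.vertexRegion hd v)) 0) * zOp (Sum.elim 0 b)) (zOp k)) :
    L.sourceGroup.map (conjHom U h₁ h₂) = L.targetGroup := by
  classical
  have hface : ∀ {f : Cell} {i : Fin (d + 1)} {j : Fin d}, L.colorsOf f = {j.succ, i}ᶜ →
      L.incidence *ᵥ L.shrunkVec j f = L.vertexVec f := fun hf => by
    convert L.incidence_mulVec_shrunkVec hd hf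
  apply le_antisymm
  · have hcyc : ∀ k, L.incidence *ᵥ k = 0 → zOp k ∈ L.targetGroup := fun k hk => by
      refine L.mem_of_incidence_mulVec_eq_zero hd (zVectors L.targetGroup)
        (fun f i j hi hf => L.zOp_shrunkVec_mem_targetGroup hd hi hf) k (by convert hk)
    rw [Subgroup.map_le_iff_le_comap]
    refine L.sourceGroup_le (fun c => ?_) (fun f => ?_) fun b => ?_
    · obtain ⟨k, hk, hU⟩ := hX (L.vertexVec c.1)
      rw [Subgroup.mem_comap, conjHom_eq_of_carries h₁ h₂ hU]
      exact mul_mem (L.xOp_ends_mem_targetGroup hd (i := L.color c.1) ⟨c.1, c.2, rfl⟩) (hcyc k hk)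
    -- The two colors missed by a 2-cell differ, so at least one is not `C_0` and supplies a shrunk
    -- lattice.
    · have hf : ∃ (i : Fin (d + 1)) (j : Fin d), i ≠ j.succ ∧ L.colorsOf f.1 = {j.succ, i}ᶜ := by
        obtain ⟨i, j, hij, hf⟩ := L.exists_colorsOf_face hd f.2
        by_cases hi : i = 0
        · obtain ⟨j, rfl⟩ := Fin.exists_succ_eq.2 fun hj : j = 0 => hij (hi.trans hj.symm)
          exact ⟨i, j, hij, by rw [hf, Set.pair_comm]⟩
        · obtain ⟨i, rfl⟩ := Fin.exists_succ_eq.2 hi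
          exact ⟨j, i, hij.symm, hf⟩
      obtain ⟨i, j, hij, hf⟩ := hf
      obtain ⟨k, hk, hU⟩ := hZ (L.shrunkVec j f.1) 0
      rw [hface hf] at hU
      rw [Subgroup.mem_comap, conjHom_eq_of_carries h₁ h₂ hU, zOp_add]
      exact mul_mem (L.zOp_shrunkVec_mem_targetGroup hd hij hf) (hcyc k hk)
    · obtain ⟨k, hk, hU⟩ := hZ 0 b
      rw [Matrix.mulVec_zero, zero_add] at hU
      rw [Subgroup.mem_comap, conjHom_eq_of_carries h₁ h₂ hU]
      exact hcyc k hk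
  · have hcyc : ∀ k, L.incidence *ᵥ k = 0 → zOp k ∈ L.sourceGroup.map (conjHom U h₁ h₂) := by
      intro k hk
      obtain ⟨α, b, hU⟩ := hK k hk
      rw [← conjHom_eq_of_carries h₁ h₂ hU]
      refine Subgroup.mem_map_of_mem _ (mul_mem ?_ (L.zOp_ancilla_mem_sourceGroup b))
      -- A vertex vector that is constant on each cell of color `C_0` is a sum of vertex sets of
      -- such cells, hence gives a product of color code generators.
      have hsum : Sum.elim (fun v => α (L.vertexRegion hd v)) 0 =
          ∑ c, if α c = 0 then 0 else Sum.elim (L.vertexVec c.1) (0 : L.Ancilla → ZMod 2) := by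
        funext q
        rw [Finset.sum_apply]
        cases q with
        | inl v =>
          rw [Finset.sum_eq_single (L.vertexRegion hd v)]
          · have h01 : ∀ s : ZMod 2, s ≠ 0 → s = 1 := by decide
            have hle := (L.vertexRegion_eq_iff hd (v := v)).1 rfl
            split_ifs with h
            · simp [h]
            · simp [vertexVec, hle, h01 _ h]
          · intro c _ hc
            have hle : ¬ v.1 ≤ c.1 := fun h => hc ((L.vertexRegion_eq_iff hd).2 h).symm
            split_ifs <;> simp [vertexVec, hle]
          · simp
        | inr a =>
          symm
          refine Finset.sum_eq_zero fun c _ => ?_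
          split_ifs <;> rfl
      rw [hsum]
      refine (xVectors L.sourceGroup).sum_mem fun c _ => ?_
      split_ifs
      · exact AddSubmonoid.zero_mem _
      · exact L.xOp_vertexVec_mem_sourceGroup ⟨c.1, c.2.1⟩
    refine L.targetGroup_le hd (fun c => ?_) fun f i j hi hf => ?_
    · obtain ⟨k, hk, hU⟩ := hX (L.vertexVec c.1)
      refine (Subgroup.mul_mem_cancel_right _ (hcyc k hk)).1 ?_
      rw [← conjHom_eq_of_carries h₁ h₂ hU]
      exact Subgroup.mem_map_of_mem _ (L.xOp_vertexVec_mem_sourceGroup c)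
    · obtain ⟨k, hk, hU⟩ := hZ (L.shrunkVec j f) 0
      refine (Subgroup.mul_mem_cancel_right _ (hcyc k hk)).1 ?_
      have hdim : L.dim f = 2 := by
        rw [L.dim_eq_of_colorsOf hd hf, Set.ncard_pair hi.symm]
      rw [← zOp_add, ← conjHom_eq_of_carries h₁ h₂ hU, hface hf]
      exact Subgroup.mem_map_of_mem _ (L.zOp_vertexVec_mem_sourceGroup ⟨f, hdim⟩)

end ColoredLattice

end

theorem theorem2 {Cell : Type*} [Finite Cell] [PartialOrder Cell] {d : ℕ} (hd : 2 ≤ d)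
    (L : ColoredLattice Cell d) :
    ∃ (U : LinOp L.TargetQubit L.SourceQubit)
      (Uc : ∀ c : L.CellOfColor 0, LinOp (L.targetRegion c) (L.sourceRegion c)),
      IsClifford U ∧ (∀ c, IsClifford (Uc c)) ∧ U = regionTensor Uc ∧
      conjBy U (groupTensor L.colorCode L.ancillaGroup) =
        groupTensorFamily (fun j : Fin d => (L.shrunk j.succ).toricCode) := by
  have := Fintype.ofFinite Cell
  have := Fintype.ofFinite (L.CellOfDim 0)
  have := Fintype.ofFinite L.TargetQubit
  obtain ⟨Uc, hUc, hU, hX, hZ, hK⟩ := L.exists_clifford_unfolding hd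
  refine ⟨regionTensor Uc, Uc, hU, hUc, rfl, ?_⟩
  rw [groupTensor_eq_image, groupTensorFamily_eq_image, conjBy_image_val _ hU.1 hU.2.1]
  exact congrArg
    (fun G : Subgroup (Op L.TargetQubit)ˣ => Units.val '' (G : Set (Op L.TargetQubit)ˣ))
    (L.map_conjHom_sourceGroup hd hU.1 hU.2.1 hX hZ hK)
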